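/- All graphs are finite, simple and undirected. Let $F$ be the set of isomorphism classes of graphs with $10$ vertices whose automorphism group is isomorphic to $\mathbb{Z}/4\mathbb{Z}$. Then: 1. $|F|=12$, and the members of $F$ form $6$ classes up to isomorphism and complementation. Every graph $\Gamma$ whose class is in $F$ has the following properties. 2. $18\le |E(\Gamma)|\le 27$. 3. The minimum degree satisfies $3\le\delta(\Gamma)\le 5$ and the maximum degree satisfies $4\le\Delta(\Gamma)\le 6$. 4. $\mathrm{Aut}(\Gamma)$ has exactly three orbits on the vertices, of sizes $4$, $4$ and $2$. 5. The girth of $\Gamma$ is $3$. 6. The clique number satisfies $3\le\omega(\Gamma)\le 4$. 7. The core of $\Gamma$ is isomorphic to $K_3$, to $K_4$ or to $\Gamma$ itself. (A core of $\Gamma$ is a subgraph $C$ such that $\Gamma$ has a homomorphism to $C$ and every homomorphism $C\to C$ is bijective; it exists and is unique up to isomorphism.) 8. The vertex connectivity $\kappa(\Gamma)$ and the edge connectivity $\lambda(\Gamma)$ satisfy $3\le\kappa(\Gamma)=\lambda(\Gamma)\le 5$. 9. $2\le\mathrm{diam}(\Gamma)\le 3$ and the radius of $\Gamma$ is $2$.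 10. The chromatic number satisfies $3\le\chi(\Gamma)\le 4$. 11. $\Gamma$ has a Hamiltonian cycle. 12. $\Gamma$ is neither vertex-transitive nor edge-transitive nor distance-transitive. Moreover: 13. Exactly one member of $F$ is planar. 14. Exactly one member of $F$ is Eulerian, that is, has a closed walk that traverses every edge exactly once. -/

import Mathlib

namespace SimpleGraph

/-- An isomorphism of graphs is also an isomorphism of their complements. -/
def isoCompl {V W : Type*} {G : SimpleGraph V} {H : SimpleGraph W} (φ : G ≃g H) : Gᶜ ≃g Hᶜ where
  toEquiv := φ.toEquiv
  map_rel_iff' := by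
    intro a b
    simp only [compl_adj]
    exact and_congr (not_congr φ.toEquiv.injective.eq_iff) (not_congr φ.map_adj_iff)

/-- The relation of isomorphism between graphs with vertex set `V`. -/
def isoSetoid (V : Type*) : Setoid (SimpleGraph V) where
  r G H := Nonempty (G ≃g H)
  iseqv :=
    { refl := fun _ => ⟨Iso.refl⟩
      symm := fun ⟨φ⟩ => ⟨φ.symm⟩
      trans := fun ⟨φ⟩ ⟨ψ⟩ => ⟨φ.trans ψ⟩ }

/-- The relation of isomorphism up to complementation: `G` is isomorphic to `H` or to the
complement of `H`. -/
def isoOrComplSetoid (V : Type*) : Setoid (SimpleGraph V) where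
  r G H := Nonempty (G ≃g H) ∨ Nonempty (G ≃g Hᶜ)
  iseqv :=
    { refl := fun _ => Or.inl ⟨Iso.refl⟩
      symm := by
        rintro G H (⟨⟨φ⟩⟩ | ⟨⟨φ⟩⟩)
        · exact Or.inl ⟨φ.symm⟩
        · refine Or.inr ⟨?_⟩
          have ψ := (isoCompl φ).symm
          rwa [compl_compl] at ψ
      trans := by
        rintro G H K (⟨⟨φ⟩⟩ | ⟨⟨φ⟩⟩) (⟨⟨ψ⟩⟩ | ⟨⟨ψ⟩⟩)
        · exact Or.inl ⟨φ.trans ψ⟩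
        · exact Or.inr ⟨φ.trans ψ⟩
        · exact Or.inr ⟨φ.trans (isoCompl ψ)⟩
        · refine Or.inl ⟨?_⟩
          have χ := φ.trans (isoCompl ψ)
          rwa [compl_compl] at χ }

/-- The set of isomorphism classes of the graphs with vertex set `V` that satisfy `P`. -/
def isoClasses {V : Type*} (P : SimpleGraph V → Prop) : Set (Quotient (isoSetoid V)) :=
  Quotient.mk (isoSetoid V) '' {G | P G}

/-- The set of classes, up to isomorphism and complementation, of the graphs with vertex set `V`
that satisfy `P`. -/
def isoOrComplClasses {V : Type*} (P : SimpleGraph V → Prop) :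
    Set (Quotient (isoOrComplSetoid V)) :=
  Quotient.mk (isoOrComplSetoid V) '' {G | P G}

/-- The automorphism group of `G` is cyclic of order `4`. -/
def HasAutZ4 {V : Type*} (G : SimpleGraph V) : Prop :=
  Nonempty ((G ≃g G) ≃* Multiplicative (ZMod 4))

/-- A graph is a core if each of its endomorphisms is a bijection of the vertex set. -/
def IsCore {V : Type*} (G : SimpleGraph V) : Prop :=
  ∀ f : G →g G, Function.Bijective f

/-- A subgraph `C` of `G` is a core of `G` if it is a core and `G` maps homomorphically to it. -/
def IsCoreOf {V : Type*} (G : SimpleGraph V) (C : G.Subgraph) : Prop :=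
  IsCore C.coe ∧ Nonempty (G →g C.coe)

/-- `G` is `k`-connected: it has more than `k` vertices, and it remains connected when fewer than
`k` vertices are removed. -/
def IsVertexConnected {V : Type*} (G : SimpleGraph V) (k : ℕ) : Prop :=
  (k : ℕ∞) < ENat.card V ∧
    ∀ X : Finset V, X.card < k → (G.induce {v | v ∉ X}).Connected

/-- The vertex connectivity of a finite graph: the greatest `k` for which it is `k`-connected. -/
noncomputable def vertexConnectivity {V : Type*} (G : SimpleGraph V) : ℕ :=
  sSup {k | G.IsVertexConnected k}

/-- The edge connectivity of a finite graph: the greatest `k` for which it is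
`k`-edge-connected. -/
noncomputable def edgeConnectivity {V : Type*} (G : SimpleGraph V) : ℕ :=
  sSup {k | G.IsEdgeConnected k}

/-- `A` is an arc in the plane with end points `x` and `y`: the image of an injective path. -/
def IsPlaneArc (x y : ℝ × ℝ) (A : Set (ℝ × ℝ)) : Prop :=
  ∃ γ : _root_.Path x y, Function.Injective γ ∧ Set.range γ = A

/-- `G` is planar: it can be drawn in the plane with its vertices as distinct points and each edge
as an arc between its end vertices, so that an arc contains no vertices but its two end vertices
and two different arcs meet at most in common end vertices. -/
def IsPlanar {V : Type*} (G : SimpleGraph V) : Prop :=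
  ∃ (p : V → ℝ × ℝ) (arc : Sym2 V → Set (ℝ × ℝ)),
    Function.Injective p ∧
    (∀ u v, G.Adj u v → IsPlaneArc (p u) (p v) (arc s(u, v))) ∧
    (∀ e ∈ G.edgeSet, ∀ w, p w ∈ arc e → w ∈ e) ∧
    (∀ e ∈ G.edgeSet, ∀ f ∈ G.edgeSet, e ≠ f →
      ∀ x ∈ arc e ∩ arc f, ∃ w, w ∈ e ∧ w ∈ f ∧ p w = x)

/-- `G` is Eulerian: it has a closed walk that traverses every edge exactly once. -/
def IsEulerianGraph {V : Type*} [DecidableEq V] (G : SimpleGraph V) : Prop :=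
  ∃ (v : V) (c : G.Walk v v), c.IsEulerian

/-- Any vertex can be mapped to any other one by an automorphism. -/
def IsVertexTransitive {V : Type*} (G : SimpleGraph V) : Prop :=
  ∀ u v, ∃ φ : G ≃g G, φ u = v

/-- Any edge can be mapped to any other one by an automorphism. -/
def IsEdgeTransitive {V : Type*} (G : SimpleGraph V) : Prop :=
  ∀ e ∈ G.edgeSet, ∀ f ∈ G.edgeSet, ∃ φ : G ≃g G, e.map φ = f

/-- Any pair of vertices can be mapped to any other pair at the same distance by an
automorphism. -/
def IsDistanceTransitive {V : Type*} (G : SimpleGraph V) : Prop :=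
  ∀ u v x y, G.edist u v = G.edist x y → ∃ φ : G ≃g G, φ u = x ∧ φ v = y

end SimpleGraph

/-! The group `ℤ/4ℤ` is abelian, so an automorphism that does not commute with a generator σ
excludes a graph. If σ had a single cycle of length four, then σa and σ³a would have the same other
neighbours, and exchanging them would be such an automorphism. Hence on ten vertices σ has two
four-cycles and fixes or exchanges the other two vertices x, y (`HasAutZ4.exists_second_cycle`,
`exists_equiv_of_two_cycles`).

Label both four-cycles by ℤ/4. The edges between them are given by a set D of differences, and every
D is invariant under some d ↦ k - d, so some reversal of both cycles preserves these edges. If σ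
fixes x and y, this reversal is an automorphism that does not commute with σ. If σ exchanges x and
y, parities matter: a suitable reversal exists unless D consists of two consecutive elements and
each vertex of the four-cycles is joined to exactly one of x, y. Up to relabelling this leaves one
skeleton with 16 edges. Still free are the circulant graph inside each four-cycle (empty, 2K₂, C₄ or
K₄) and the edge xy: these are the 32 graphs `rotGraph c`. If the circulants agree, an interchange
of the four-cycles is a forbidden automorphism; otherwise their order is irrelevant. This leaves 6 ·
2 = 12 graphs, listed in `params`. A search shows that they have no automorphisms but the rotations,
and the number of edges with the minimum degree tells them apart. Complementation toggles xy, so the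
twelve form six pairs.

The other claims are finite checks on the twelve graphs, transported along isomorphisms.
Connectivity is read off from the boundaries of all sets of vertices. A core K₃ or K₄ comes from a
clique and a colouring with equally many colours; in the remaining cases a search shows that all
endomorphisms are injective. Nonplanarity rests on a parity argument with winding numbers for K₃,₃
(`not_disjoint_curves`), planarity on an explicit straight line drawing. -/

/-! ### Continuous logarithms and the parity obstruction for K₃,₃ -/

/-- A continuous nowhere zero complex function on a simply connected, locally path connected
space has a continuous logarithm. -/
theorem exists_continuous_log {X : Type*} [TopologicalSpace X] [SimplyConnectedSpace X]
    [LocallyPathConnectedSpace X] {g : X → ℂ} (hg : Continuous g) (h0 : ∀ x, g x ≠ 0) :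
    ∃ L : X → ℂ, Continuous L ∧ ∀ x, Complex.exp (L x) = g x := by
  obtain ⟨x₀⟩ : Nonempty X := inferInstance
  obtain ⟨F, ⟨-, hF⟩, -⟩ := Complex.isCoveringMapOn_exp.existsUnique_continuousMap_lifts
    (f := ⟨g, hg⟩) (a₀ := x₀) (e₀ := Complex.log (g x₀)) (by simp [Complex.exp_log (h0 x₀)])
    (fun x => by simpa using h0 x)
  exact ⟨F, F.continuous, fun x => congrFun hF x⟩

/-- Translating `M` to start at `L 0` gives another lift of `g` through the exponential covering;
lifts with the same start agree. -/
theorem continuous_log_sub_eq {g L M : ℝ → ℂ} (hL : Continuous L) (hM : Continuous M)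
    (hLg : ∀ t, Complex.exp (L t) = g t) (hMg : ∀ t, Complex.exp (M t) = g t) :
    L 1 - L 0 = M 1 - M 0 := by
  have hg : Continuous g := (Complex.continuous_exp.comp hL).congr hLg
  have h0 : ∀ t, g t ≠ 0 := fun t => hLg t ▸ Complex.exp_ne_zero _
  have hu := (Complex.isCoveringMapOn_exp.existsUnique_continuousMap_lifts
    (f := ⟨g, hg⟩) (a₀ := (0 : ℝ)) (e₀ := L 0) (by simp [hLg])
    (fun x => by simpa using h0 x)).unique
    (y₁ := ⟨L, hL⟩) (y₂ := ⟨fun t => M t + (L 0 - M 0), by fun_prop⟩)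
    ⟨rfl, funext hLg⟩ ⟨by simp, funext fun t => by simp [Complex.exp_add, Complex.exp_sub, hLg, hMg, h0]⟩
  have h1 := congrArg (fun F : C(ℝ, ℂ) => F 1) hu
  simp only [ContinuousMap.coe_mk] at h1
  rw [h1]; ring

open Classical in
/-- The increment of a continuous logarithm of `g` between `0` and `1`. -/
noncomputable def logIncrement (g : ℝ → ℂ) : ℂ :=
  if h : ∃ L : ℝ → ℂ, Continuous L ∧ ∀ t, Complex.exp (L t) = g t then
    h.choose 1 - h.choose 0 else 0

theorem logIncrement_eq {g L : ℝ → ℂ} (hL : Continuous L)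
    (hLg : ∀ t, Complex.exp (L t) = g t) : logIncrement g = L 1 - L 0 := by
  have h : ∃ L : ℝ → ℂ, Continuous L ∧ ∀ t, Complex.exp (L t) = g t := ⟨L, hL, hLg⟩
  rw [logIncrement, dif_pos h]
  exact continuous_log_sub_eq h.choose_spec.1 hL h.choose_spec.2 hLg

theorem logIncrement_neg {g : ℝ → ℂ} (hg : Continuous g) (h0 : ∀ t, g t ≠ 0) :
    logIncrement (fun t => - g t) = logIncrement g := by
  obtain ⟨L, hL, hLg⟩ := exists_continuous_log hg h0
  rw [logIncrement_eq hL hLg, logIncrement_eq (L := fun t => L t + Real.pi * Complex.I)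
    (by fun_prop) (fun t => by simp [Complex.exp_add, hLg])]
  ring

theorem exists_logIncrement_eq {g : ℝ → ℂ} (hg : Continuous g) (h0 : ∀ t, g t ≠ 0) {a b : ℂ}
    (ha : Complex.exp a = g 0) (hb : Complex.exp b = g 1) :
    ∃ n : ℤ, logIncrement g = b - a + n * (2 * Real.pi * Complex.I) := by
  obtain ⟨L, hL, hLg⟩ := exists_continuous_log hg h0
  obtain ⟨m, hm⟩ := Complex.exp_eq_exp_iff_exists_int.1 ((hLg 0).trans ha.symm)
  obtain ⟨n, hn⟩ := Complex.exp_eq_exp_iff_exists_int.1 ((hLg 1).trans hb.symm)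
  refine ⟨n - m, ?_⟩
  rw [logIncrement_eq hL hLg, hm, hn]
  push_cast; ring

/-- The logarithm increments of a nowhere zero difference of two curves cancel around the
boundary of the unit square. -/
theorem logIncrement_square {f g : ℝ → ℂ} (hf : Continuous f) (hg : Continuous g)
    (h : ∀ s t, f s ≠ g t) :
    logIncrement (fun s => f s - g 0) + logIncrement (fun t => g t - f 1) =
      logIncrement (fun s => f s - g 1) + logIncrement (fun t => g t - f 0) := by
  obtain ⟨L, hL, hLg⟩ := exists_continuous_log (X := ℝ × ℝ) (g := fun x => f x.1 - g x.2)
    (by fun_prop) (fun x => sub_ne_zero.2 (h _ _))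
  have h1 : ∀ t, logIncrement (fun s => f s - g t) = L (1, t) - L (0, t) := fun t =>
    logIncrement_eq (L := fun s => L (s, t)) (by fun_prop) (fun s => hLg (s, t))
  have h2 : ∀ s, logIncrement (fun t => g t - f s) = L (s, 1) - L (s, 0) := fun s => by
    have : (fun t => g t - f s) = fun t => - (f s - g t) := by ext; ring
    rw [this, logIncrement_neg (by fun_prop) (fun t => sub_ne_zero.2 (h s t))]
    exact logIncrement_eq (L := fun t => L (s, t)) (by fun_prop) (fun t => hLg (s, t))
  rw [h1, h1, h2, h2]; ring

/-- A parity obstruction to drawing `K₃,₃` in the plane: nine curves that join each of three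
points to each of three points cannot be such that curves without common end points are
disjoint. -/
theorem not_disjoint_curves (p q : Fin 3 → ℂ) (γ : Fin 3 → Fin 3 → ℝ → ℂ)
    (hγ : ∀ i j, Continuous (γ i j)) (hp : ∀ i j, γ i j 0 = p i) (hq : ∀ i j, γ i j 1 = q j) :
    ¬ ∀ i j k l, i ≠ k → j ≠ l → ∀ s t, γ i j s ≠ γ k l t := by
  intro h
  have hpq : ∀ i j, p i ≠ q j := fun i j => by
    have := h i (j + 1) (i + 1) j (by decide +revert) (by decide +revert) 0 1
    rwa [hp, hq] at this
  have hpp : ∀ i k, i ≠ k → p i ≠ p k := fun i k hik => by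
    simpa [hp] using h i 0 k 1 hik (by decide) 0 0
  have hqq : ∀ j l, j ≠ l → q j ≠ q l := fun j l hjl => by
    simpa [hq] using h 0 j 1 l (by decide) hjl 1 1
  set c : ℂ := Real.pi * Complex.I with hc
  have hc0 : c ≠ 0 := by simp [hc, Real.pi_ne_zero]
  have hexp : Complex.exp c = -1 := Complex.exp_pi_mul_I
  let A : Fin 3 → Fin 3 → ℂ := fun i j => Complex.log (p i - q j)
  -- A logarithm is chosen for one sign of each difference only; the other sign costs exactly one
  -- `c`, and these half turns produce the parity.
  let B : (Fin 3 → ℂ) → Fin 3 → Fin 3 → ℂ := fun r i k =>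
    if i < k then Complex.log (r i - r k) else Complex.log (r k - r i) + c
  have hA : ∀ i j, Complex.exp (A i j) = p i - q j := fun i j =>
    Complex.exp_log (sub_ne_zero.2 (hpq i j))
  have hB : ∀ r : Fin 3 → ℂ, (∀ i k, i ≠ k → r i ≠ r k) → ∀ i k, i ≠ k →
      Complex.exp (B r i k) = r i - r k := fun r hr i k hik => by
    by_cases hlt : i < k
    · simp only [B, hlt, if_true]; exact Complex.exp_log (sub_ne_zero.2 (hr i k hik))
    · simp only [B, hlt, if_false]
      rw [Complex.exp_add, Complex.exp_log (sub_ne_zero.2 (hr k i hik.symm)), hexp]; ring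
  have hBB : ∀ r i k, i < k → B r k i = B r i k + c := fun r i k hik => by
    simp [B, hik, not_lt.2 hik.le]
  -- The integer is asserted to exist for all indices, with default `0` when `j = l`, so that
  -- `choose` yields a total function.
  have hn : ∀ i j l, ∃ n : ℤ, j ≠ l → logIncrement (fun t => γ i j t - q l) =
      B q j l - A i l + n * (2 * c) := fun i j l => by
    by_cases hjl : j = l
    · exact ⟨0, fun h => absurd hjl h⟩
    obtain ⟨n, hn⟩ := exists_logIncrement_eq (g := fun t => γ i j t - q l) (a := A i l)
      (b := B q j l) (by have := hγ i j; fun_prop)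
      (fun t => sub_ne_zero.2 (by
        have := h i j (i + 1) l (by decide +revert) hjl t 1
        rwa [hq] at this)) (by rw [hA, hp]) (by rw [hB q hqq j l hjl, hq])
    exact ⟨n, fun _ => by rw [hn, hc]; ring⟩
  -- The end value is `q j - p k = -(p k - q j)`, whence the summand `c`.
  have hm : ∀ i j k, ∃ n : ℤ, i ≠ k → logIncrement (fun t => γ i j t - p k) =
      A k j + c - B p i k + n * (2 * c) := fun i j k => by
    by_cases hik : i = k
    · exact ⟨0, fun h => absurd hik h⟩
    obtain ⟨n, hn⟩ := exists_logIncrement_eq (g := fun t => γ i j t - p k) (a := B p i k)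
      (b := A k j + c) (by have := hγ i j; fun_prop)
      (fun t => sub_ne_zero.2 (by
        have := h i j k (j + 1) hik (by decide +revert) t 0
        rwa [hp] at this)) (by rw [hB p hpp i k hik, hp])
        (by rw [Complex.exp_add, hA, hexp, hq]; ring)
    exact ⟨n, fun _ => by rw [hn, hc]; ring⟩
  choose n hn using hn
  choose m hm using hm
  -- In the cancellation around the square for `γ i j` and `γ k l` the chosen logarithms drop out.
  -- The half turns from `B p` and `B q` leave `2 * c` if `j < l` and nothing otherwise.
  have key : ∀ i j k l, i < k → j ≠ l →
      (if j < l then (1 : ℤ) else 0) + (m i j k + n k l j - n i j l - m k l i) = 0 := by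
    intro i j k l hik hjl
    have hs := logIncrement_square (hγ i j) (hγ k l) (h i j k l hik.ne hjl)
    rw [hp, hp, hq, hq, hm _ _ _ hik.ne, hm _ _ _ hik.ne', hn _ _ _ hjl, hn _ _ _ hjl.symm,
      hBB p i k hik] at hs
    have : (((if j < l then (1 : ℤ) else 0) + (m i j k + n k l j - n i j l - m k l i) : ℤ) : ℂ)
        * (2 * c) = 0 := by
      rcases lt_or_gt_of_ne hjl with hlt | hlt
      · rw [hBB q j l hlt] at hs
        rw [if_pos hlt]; push_cast; linear_combination hs
      · rw [hBB q l j hlt] at hs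
        rw [if_neg (not_lt.2 hlt.le)]; push_cast; linear_combination hs
    exact_mod_cast (mul_eq_zero.1 this).resolve_right (by simp [hc0])
  -- In the sum of the eighteen relations each `m` has coefficient ±2 and each `n x j l` has `2 * x
  -- - 2`, all even, while the indicators of `j < l` add up to 9.
  have k01 := fun j l => key 0 j 1 l (by decide)
  have k02 := fun j l => key 0 j 2 l (by decide)
  have k12 := fun j l => key 1 j 2 l (by decide)
  have hall : ∀ P : Fin 3 → Fin 3 → Prop, (∀ j l, j ≠ l → P j l) →
      P 0 1 ∧ P 0 2 ∧ P 1 2 ∧ P 1 0 ∧ P 2 0 ∧ P 2 1 := fun P hP =>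
    ⟨hP _ _ (by decide), hP _ _ (by decide), hP _ _ (by decide), hP _ _ (by decide),
      hP _ _ (by decide), hP _ _ (by decide)⟩
  have k01 := hall _ k01
  have k02 := hall _ k02
  have k12 := hall _ k12
  simp at k01 k02 k12
  omega

/-! ### Criteria for planarity and nonplanarity -/

namespace SimpleGraph

variable {V W : Type*} {G : SimpleGraph V} {H : SimpleGraph W}

theorem IsPlanar.of_injective_hom (hH : H.IsPlanar) (f : G →g H) (hf : Function.Injective f) :
    G.IsPlanar := by
  obtain ⟨p, arc, hp, h1, h2, h3⟩ := hH
  refine ⟨p ∘ f, fun e => arc (e.map f), hp.comp hf, fun u v huv => h1 _ _ (f.map_adj huv),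
    fun e he w hw => ?_, fun e he e' he' hne x hx => ?_⟩
  · obtain ⟨v, hv, hvw⟩ := Sym2.mem_map.1 (h2 _ (f.map_mem_edgeSet he) _ hw)
    exact hf hvw ▸ hv
  · obtain ⟨w, hw, hw', rfl⟩ := h3 _ (f.map_mem_edgeSet he) _ (f.map_mem_edgeSet he')
      (fun h => hne (Sym2.map.injective hf h)) x hx
    obtain ⟨v, hv, rfl⟩ := Sym2.mem_map.1 hw
    obtain ⟨v', hv', hvv⟩ := Sym2.mem_map.1 hw'
    exact ⟨v, hv, hf hvv ▸ hv', rfl⟩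

/-- The arcs along a walk are concatenated. The curve need not be injective; only its position
relative to the vertices and arcs of the walk matters. -/
theorem exists_path_of_isChain {p : V → ℝ × ℝ} {arc : Sym2 V → Set (ℝ × ℝ)}
    (harc : ∀ u v, G.Adj u v → IsPlaneArc (p u) (p v) (arc s(u, v))) {w : V} :
    ∀ (u : V) (l : List V), (u :: l).IsChain G.Adj → (u :: l).getLast? = some w →
      ∃ γ : _root_.Path (p u) (p w), ∀ t, (∃ v ∈ u :: l, γ t = p v) ∨
        ∃ a ∈ u :: l, ∃ b ∈ u :: l, G.Adj a b ∧ γ t ∈ arc s(a, b) := by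
  intro u l
  induction l generalizing u with
  | nil =>
    intro _ hw
    obtain rfl : u = w := by simpa using hw
    exact ⟨_root_.Path.refl _, fun t => Or.inl ⟨u, by simp, rfl⟩⟩
  | cons v l ih =>
    intro hc hw
    obtain ⟨δ, hδ⟩ := ih v hc.of_cons (by simpa using hw)
    have huv : G.Adj u v := hc.rel
    obtain ⟨ε, -, hε⟩ := harc u v huv
    refine ⟨ε.trans δ, fun t => ?_⟩
    have ht : (ε.trans δ) t ∈ Set.range ε ∪ Set.range δ := by
      rw [← _root_.Path.trans_range]; exact ⟨t, rfl⟩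
    rcases ht with ht | ⟨t', ht⟩
    · exact Or.inr ⟨u, by simp, v, by simp, huv, hε ▸ ht⟩
    · rw [← ht]
      rcases hδ t' with ⟨v', hv', h⟩ | ⟨a, ha, b, hb, h⟩
      · exact Or.inl ⟨v', List.mem_cons_of_mem _ hv', h⟩
      · exact Or.inr ⟨a, List.mem_cons_of_mem _ ha, b, List.mem_cons_of_mem _ hb, h⟩

/-- A graph that contains a subdivision of `K₃,₃` is not planar. -/
theorem not_isPlanar_of_subdivision (u w : Fin 3 → V) (l : Fin 3 → Fin 3 → List V)
    (hc : ∀ i j, (u i :: l i j).IsChain G.Adj)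
    (hw : ∀ i j, (u i :: l i j).getLast? = some (w j))
    (hd : ∀ i j i' j', i ≠ i' → j ≠ j' → (u i :: l i j).Disjoint (u i' :: l i' j')) :
    ¬ G.IsPlanar := by
  rintro ⟨p, arc, hp, h1, h2, h3⟩
  choose γ hγ using fun i j => exists_path_of_isChain h1 (u i) (l i j) (hc i j) (hw i j)
  let z : ℝ × ℝ → ℂ := Complex.equivRealProdCLM.symm
  have hz : Continuous z := Complex.equivRealProdCLM.symm.continuous
  have hzi : Function.Injective z := Complex.equivRealProdCLM.symm.injective
  refine not_disjoint_curves (fun i => z (p (u i))) (fun j => z (p (w j)))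
    (fun i j t => z ((γ i j).extend t)) (fun i j => hz.comp (γ i j).continuous_extend)
    (by simp) (by simp) fun i j i' j' hi hj s t heq => ?_
  have heq := hzi heq
  simp only [_root_.Path.extend, Set.IccExtend] at heq
  have hdis := hd i j i' j' hi hj
  rcases hγ i j (Set.projIcc 0 1 zero_le_one s) with ⟨v, hv, h⟩ | ⟨a, ha, b, hb, hab, h⟩ <;>
  rcases hγ i' j' (Set.projIcc 0 1 zero_le_one t) with ⟨v', hv', h'⟩ | ⟨a', ha', b', hb', hab', h'⟩
  · exact hdis hv (hp (h.symm.trans (heq.trans h')) ▸ hv')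
  · rcases Sym2.mem_iff.1 (h2 _ hab' v (by rw [← h]; exact heq ▸ h')) with rfl | rfl
    · exact hdis hv ha'
    · exact hdis hv hb'
  · rcases Sym2.mem_iff.1 (h2 _ hab v' (by rw [← h']; exact heq ▸ h)) with rfl | rfl
    · exact hdis ha hv'
    · exact hdis hb hv'
  -- The two edges have no common vertex, hence they are different, and a common point of their arcs
  -- would have to be a common end.
  · have key : ∀ x, x ∈ s(a, b) → x ∈ s(a', b') → False := fun x hx hx' => by
      rcases Sym2.mem_iff.1 hx with rfl | rfl <;> rcases Sym2.mem_iff.1 hx' with rfl | rfl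
      · exact hdis ha ha'
      · exact hdis ha hb'
      · exact hdis hb ha'
      · exact hdis hb hb'
    obtain ⟨x, hx, hx', -⟩ := h3 _ hab _ hab'
      (fun h => key a (Sym2.mem_mk_left _ _) (by rw [← h]; exact Sym2.mem_mk_left _ _)) _ ⟨h, heq ▸ h'⟩
    exact key x hx hx'

theorem isPlaneArc_segment {x y : ℝ × ℝ} (h : x ≠ y) : IsPlaneArc x y (segment ℝ x y) := by
  refine ⟨⟨⟨fun t => AffineMap.lineMap x y (t : ℝ), by fun_prop⟩, by simp, by simp⟩, ?_, ?_⟩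
  · exact (AffineMap.lineMap_injective ℝ h).comp Subtype.val_injective
  · rw [segment_eq_image_lineMap]
    ext z
    simp only [Set.mem_range, Set.mem_image, Subtype.exists]
    exact ⟨fun ⟨a, ha, h⟩ => ⟨a, ha, h⟩, fun ⟨a, ha, h⟩ => ⟨a, ha, h⟩⟩

/-- Twice the signed area of the triangle `x y z`. -/
def orientation {R : Type*} [CommRing R] (x y z : R × R) : R :=
  (y.1 - x.1) * (z.2 - x.2) - (y.2 - x.2) * (z.1 - x.1)

theorem orientation_combo (x y z w : ℝ × ℝ) {a b : ℝ} (hab : a + b = 1) :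
    orientation x y (a • z + b • w) = a * orientation x y z + b * orientation x y w := by
  obtain rfl := eq_sub_of_add_eq hab
  simp only [orientation, Prod.fst_add, Prod.snd_add, Prod.smul_fst, Prod.smul_snd, smul_eq_mul]
  ring

theorem orientation_eq_zero_of_mem_segment {x y z : ℝ × ℝ} (hz : z ∈ segment ℝ x y) :
    orientation x y z = 0 := by
  obtain ⟨a, b, -, -, hab, rfl⟩ := hz
  rw [orientation_combo _ _ _ _ hab]; simp only [orientation]; ring

theorem disjoint_segment_of_orientation {x y z w : ℝ × ℝ}
    (h : 0 < orientation x y z * orientation x y w) :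
    Disjoint (segment ℝ x y) (segment ℝ z w) := by
  refine Set.disjoint_left.2 fun v hv ⟨a, b, ha, hb, hab, hvw⟩ => ?_
  have h0 := orientation_eq_zero_of_mem_segment hv
  rw [← hvw, orientation_combo _ _ _ _ hab] at h0
  -- Multiplication by `orientation x y z` makes both summands nonnegative, so both vanish and `a =
  -- b = 0`, against `a + b = 1`.
  have h1 : a * orientation x y z ^ 2 + b * (orientation x y z * orientation x y w) = 0 := by
    linear_combination orientation x y z * h0
  have hz : 0 < orientation x y z ^ 2 := by
    have : orientation x y z ≠ 0 := left_ne_zero_of_mul h.ne'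
    positivity
  have ha0 := (add_eq_zero_iff_of_nonneg (by positivity) (by positivity)).1 h1
  have ha1 := (mul_eq_zero.1 ha0.1).resolve_right hz.ne'
  have hb1 := (mul_eq_zero.1 ha0.2).resolve_right h.ne'
  linarith

theorem segment_inter_segment_subset {x y z : ℝ × ℝ} (h : orientation x y z ≠ 0) :
    segment ℝ x y ∩ segment ℝ x z ⊆ {x} := by
  rintro v ⟨hv, a, b, -, -, hab, rfl⟩
  have h0 := orientation_eq_zero_of_mem_segment hv
  rw [orientation_combo _ _ _ _ hab] at h0
  have hx : orientation x y x = 0 := by simp [orientation]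
  obtain rfl : b = 0 := by simpa [hx, h] using h0
  obtain rfl : a = 1 := by linarith
  simp

/-- A straight line drawing in which no vertex lies on the line through an edge that it is not an
end of, and edges without common ends are separated by the line through one of them, shows that
the graph is planar. -/
theorem isPlanar_of_orientation (q : V → ℤ × ℤ) (hq : Function.Injective q)
    (h1 : ∀ u v, G.Adj u v → ∀ w, w ≠ u → w ≠ v → orientation (q u) (q v) (q w) ≠ 0)
    (h2 : ∀ u v, G.Adj u v → ∀ w z, G.Adj w z → u ≠ w → u ≠ z → v ≠ w → v ≠ z →
      0 < orientation (q u) (q v) (q w) * orientation (q u) (q v) (q z) ∨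
      0 < orientation (q w) (q z) (q u) * orientation (q w) (q z) (q v)) :
    G.IsPlanar := by
  let p : V → ℝ × ℝ := fun v => ((q v).1, (q v).2)
  have hp : Function.Injective p := fun u v h => hq (by
    simp only [p, Prod.mk.injEq, Int.cast_inj] at h
    exact Prod.ext h.1 h.2)
  have ho : ∀ u v w, orientation (p u) (p v) (p w) = (orientation (q u) (q v) (q w) : ℤ) := by
    intro u v w; simp [orientation, p]
  have h1' : ∀ u v, G.Adj u v → ∀ w, w ≠ u → w ≠ v → orientation (p u) (p v) (p w) ≠ 0 :=
    fun u v huv w hu hv => by rw [ho]; exact_mod_cast h1 u v huv w hu hv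
  have hcommon : ∀ u v z, G.Adj u v → G.Adj u z → v ≠ z →
      ∀ x ∈ segment ℝ (p u) (p v) ∩ segment ℝ (p u) (p z), p u = x := fun u v z huv huz hvz x hx =>
    (segment_inter_segment_subset (h1' u v huv z huz.ne' hvz.symm) hx).symm
  refine ⟨p, Sym2.lift ⟨fun u v => segment ℝ (p u) (p v), fun u v => segment_symm ℝ _ _⟩, hp,
    fun u v huv => isPlaneArc_segment (hp.ne huv.ne), ?_, ?_⟩
  · refine Sym2.ind fun u v huv w hw => ?_
    by_contra hne
    rw [Sym2.mem_iff, not_or] at hne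
    exact h1' u v huv w hne.1 hne.2 (orientation_eq_zero_of_mem_segment hw)
  · refine Sym2.ind fun u v huv => Sym2.ind fun w z hwz hne x hx => ?_
    simp only [mem_edgeSet, Sym2.lift_mk] at huv hwz hx
    simp only [Sym2.mem_iff]
    by_cases huw : u = w
    · subst huw
      exact ⟨u, by simp, by simp, hcommon u v z huv hwz (fun h => hne (h ▸ rfl)) x hx⟩
    by_cases huz : u = z
    · subst huz
      rw [segment_symm ℝ (p w)] at hx
      exact ⟨u, by simp, by simp, hcommon u v w huv hwz.symm
        (fun h => hne (h ▸ Sym2.eq_swap)) x hx⟩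
    by_cases hvw : v = w
    · subst hvw
      rw [segment_symm ℝ (p u)] at hx
      exact ⟨v, by simp, by simp, hcommon v u z huv.symm hwz
        (fun h => hne (h ▸ Sym2.eq_swap)) x hx⟩
    by_cases hvz : v = z
    · subst hvz
      rw [segment_symm ℝ (p u), segment_symm ℝ (p w)] at hx
      exact ⟨v, by simp, by simp, hcommon v u w huv.symm hwz.symm
        (fun h => hne (h ▸ rfl)) x hx⟩
    exfalso
    rcases h2 u v huv w z hwz huw huz hvw hvz with h | h
    · exact Set.disjoint_left.1 (disjoint_segment_of_orientation
        (by rw [ho, ho]; exact_mod_cast h)) hx.1 hx.2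
    · exact Set.disjoint_left.1 (disjoint_segment_of_orientation
        (by rw [ho, ho]; exact_mod_cast h)) hx.2 hx.1

/-! ### The family of graphs invariant under the rotation -/

/-- The orbits on pairs of vertices of `(0 1 2 3)(4 5 6 7)(8 9)`, one hexadecimal digit for each
pair, the last digit for `(0, 0)`; the diagonal is marked `d`. -/
def orbitTable : ℕ :=
  0xdc67674545cd7676545467daba012376adab301267bada230176abad1230450321d8985410328d8945210398d8543210898d

/-- The orbits on pairs of vertices of `(0 1 2 3)(4 5 6 7)`, in the same way. -/
def orbitTableFix : ℕ :=
  0xdc77775555cd6666444476daba012376adab301276bada230176abad1230540321d8985410328d8954210398d8543210898d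

/-- The orbit of the pair `(i, j)` in a table of orbits. -/
def entry (T i j : ℕ) : ℕ := (T >>> (4 * (10 * i + j))) % 16

/-- The graph on ten vertices whose edges are the orbits of `(0 1 2 3)(4 5 6 7)(8 9)` that
correspond to the digits of `83 + 256 * c`. -/
def rotGraph (c : ℕ) : SimpleGraph (Fin 10) where
  Adj i j := i ≠ j ∧ (83 + 256 * c).testBit (entry orbitTable i j)
  symm := ⟨fun i j h => ⟨h.1.symm, by
    have : ∀ i j : Fin 10, entry orbitTable i j = entry orbitTable j i := by decide +kernel
    rw [this]; exact h.2⟩⟩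
  loopless := ⟨fun _ h => h.1 rfl⟩

instance (c : ℕ) : DecidableRel (rotGraph c).Adj := fun _ _ => instDecidableAnd

/-- The parameters of the graphs with cyclic automorphism group of order four. -/
def params : List ℕ := [1, 2, 3, 6, 7, 11, 17, 18, 19, 22, 23, 27]

/-- The rotation `(0 1 2 3)(4 5 6 7)(8 9)`. -/
def rot : Fin 10 → Fin 10 := ![1, 2, 3, 0, 5, 6, 7, 4, 9, 8]

/-! ### Exhaustive search for automorphisms and endomorphisms -/

section search

/-- Whether `l` (the values at `l.length - 1, …, 0`) can be extended by `v` so that the pairwise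
condition `R` is kept. -/
def canExtend (R : ℕ → ℕ → ℕ → ℕ → Bool) (k v : ℕ) : List ℕ → Bool
  | [] => true
  | w :: l => R l.length k w v && canExtend R k v l

/-- Whether all extensions of `l` by `k` further values below `n` that keep the pairwise condition
`R` satisfy `Q`. -/
def forallExtensions (R : ℕ → ℕ → ℕ → ℕ → Bool) (n : ℕ) (Q : List ℕ → Bool) :
    ℕ → List ℕ → Bool
  | 0, l => Q l
  | k + 1, l => (List.range n).all fun v =>
      !canExtend R l.length v l || forallExtensions R n Q k (v :: l)

/-- The list of the values `f (k - 1), …, f 0`. -/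
def valueList (f : ℕ → ℕ) : ℕ → List ℕ
  | 0 => []
  | k + 1 => f k :: valueList f k

theorem length_valueList (f : ℕ → ℕ) (k : ℕ) : (valueList f k).length = k := by
  induction k with
  | zero => rfl
  | succ k ih => simp [valueList, ih]

theorem canExtend_valueList {R : ℕ → ℕ → ℕ → ℕ → Bool} {f : ℕ → ℕ} {k m : ℕ}
    (h : ∀ i < k, R i m (f i) (f m)) : canExtend R m (f m) (valueList f k) := by
  induction k with
  | zero => rfl
  | succ k ih =>
    simp only [valueList, canExtend, length_valueList, Bool.and_eq_true]
    exact ⟨h k (by omega), ih fun i hi => h i (by omega)⟩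

/-- The initial segments of a function that satisfies the pairwise condition follow a branch of the
search that is never cut off. -/
theorem forallExtensions_valueList {R : ℕ → ℕ → ℕ → ℕ → Bool} {n : ℕ} {Q : List ℕ → Bool}
    {f : ℕ → ℕ} {N : ℕ} (hn : ∀ i < N, f i < n) (hR : ∀ j < N, ∀ i < j, R i j (f i) (f j))
    {k i : ℕ} (hik : i + k = N) (h : forallExtensions R n Q k (valueList f i)) :
    Q (valueList f N) := by
  induction k generalizing i with
  | zero => simpa [forallExtensions, ← hik] using h
  | succ k ih =>
    simp only [forallExtensions, List.all_eq_true, List.mem_range, length_valueList] at h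
    have := h (f i) (hn i (by omega))
    rw [canExtend_valueList (hR i (by omega))] at this
    exact ih (i := i + 1) (by omega) (by simpa [valueList] using this)

end search

/-- The order in which the vertices are treated in a search. -/
def searchOrder : List ℕ := [0, 2, 8, 4, 6, 5, 1, 9, 3, 7]

/-- The adjacency of `rotGraph c` as a Boolean function. -/
def adjb (c i j : ℕ) : Bool := (83 + 256 * c).testBit (entry orbitTable i j)

/-- The condition that a homomorphism satisfies on a pair of vertices. -/
def homCond (c a b a' b' : ℕ) : Bool :=
  !adjb c (searchOrder.getD a 0) (searchOrder.getD b 0) || adjb c a' b'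

/-- The condition that an automorphism satisfies on a pair of vertices. -/
def autCond (c a b a' b' : ℕ) : Bool :=
  a' != b' && adjb c (searchOrder.getD a 0) (searchOrder.getD b 0) == adjb c a' b'

theorem params_lt {c : ℕ} (hc : c ∈ params) : c < 32 := by revert c; decide

theorem rotGraph_adj_iff {c : ℕ} (hc : c < 32) (i j : Fin 10) :
    (rotGraph c).Adj i j ↔ adjb c i j = true := by
  -- The digit 13 marks the diagonal, and `83 + 256 * c < 2 ^ 13` because `c < 32`; so the bit test
  -- alone excludes loops.
  have hd : ∀ i j : Fin 10, entry orbitTable i j = 13 ↔ i = j := by decide +kernel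
  refine ⟨fun h => h.2, fun h => ⟨fun hij => ?_, h⟩⟩
  rw [adjb, (hd i j).2 hij, Nat.testBit_lt_two_pow (by omega)] at h
  exact Bool.noConfusion h

/-- The vertices `0`, `4`, `8` represent the cycles of the rotation; after composition with a
rotation the first image is one of them, and then only the identity survives. -/
theorem forallExtensions_aut : ∀ c ∈ params, ∀ v ∈ [0, 4, 8], forallExtensions (autCond c) 10
    (fun l => l == searchOrder.reverse) 9 [v] := by
  decide +kernel

theorem forallExtensions_hom : ∀ c ∈ [2, 6, 18, 22], ∀ v ∈ [0, 4, 8],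
    forallExtensions (homCond c) 10 (fun l => decide l.Nodup) 9 [v] := by
  decide +kernel

/-- The rotation as an automorphism. -/
def rotIso (c : ℕ) : rotGraph c ≃g rotGraph c where
  toFun := rot
  invFun := rot^[3]
  left_inv := fun i => by revert i; decide
  right_inv := fun i => by revert i; decide
  map_rel_iff' := by
    have h : ∀ i j, (rot i ≠ rot j ↔ i ≠ j) ∧
        entry orbitTable (rot i) (rot j) = entry orbitTable i j := by decide +kernel
    intro i j
    change (_ ∧ _) ↔ (_ ∧ _)
    rw [Equiv.coe_fn_mk, (h i j).1, (h i j).2]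

theorem rotIso_pow_apply (c k : ℕ) (i : Fin 10) : (rotIso c ^ k) i = rot^[k] i := by
  induction k generalizing i with
  | zero => rfl
  | succ k ih => rw [pow_succ, Function.iterate_succ_apply, ← ih]; rfl

/-- The vertices in the order of a search. -/
def searchVertex (i : ℕ) : Fin 10 := Fin.ofNat 10 (searchOrder.getD i 0)

theorem searchVertex_surjOn (v : Fin 10) : ∃ i < 10, searchVertex i = v := by
  revert v; decide +kernel

theorem val_searchVertex (i : ℕ) (hi : i < 10) : (searchVertex i : ℕ) = searchOrder.getD i 0 := by
  revert i; decide +kernel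

/-- A map of vertices, followed by a power of the rotation, is found by a search that starts with
the vertices `0`, `4` and `8` only. -/
theorem exists_rot_search {R : ℕ → ℕ → ℕ → ℕ → Bool} {Q : List ℕ → Bool}
    (hs : ∀ v ∈ [0, 4, 8], forallExtensions R 10 Q 9 [v]) (f : Fin 10 → Fin 10)
    (hR : ∀ k, ∀ j < 10, ∀ i < j,
      R i j (rot^[k] (f (searchVertex i))) (rot^[k] (f (searchVertex j)))) :
    ∃ k < 4, Q (valueList (fun i => (rot^[k] (f (searchVertex i)) : ℕ)) 10) := by
  have h : ∀ v, ∃ k < 4, (rot^[k] v : ℕ) ∈ [0, 4, 8] := by decide +kernel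
  obtain ⟨k, hk, hv⟩ := h (f (searchVertex 0))
  exact ⟨k, hk, forallExtensions_valueList (k := 9) (i := 1) (fun i _ => Fin.is_lt _) (hR k) rfl
    (hs _ hv)⟩

theorem valueList_congr {f g : ℕ → ℕ} {k : ℕ} (h : valueList f k = valueList g k) :
    ∀ i < k, f i = g i := by
  induction k with
  | zero => omega
  | succ k ih =>
    simp only [valueList, List.cons.injEq] at h
    intro i hi
    rcases Nat.lt_succ_iff_lt_or_eq.1 hi with h' | rfl
    exacts [ih h.2 i h', h.1]

theorem mem_valueList {f : ℕ → ℕ} {k i : ℕ} (hi : i < k) : f i ∈ valueList f k := by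
  induction k with
  | zero => omega
  | succ k ih =>
    rcases Nat.lt_succ_iff_lt_or_eq.1 hi with h' | rfl
    exacts [List.mem_cons_of_mem _ (ih h'), List.mem_cons_self]

theorem injOn_of_nodup_valueList {f : ℕ → ℕ} {k : ℕ} (h : (valueList f k).Nodup) :
    ∀ j < k, ∀ i < j, f i ≠ f j := by
  induction k with
  | zero => omega
  | succ k ih =>
    simp only [valueList, List.nodup_cons] at h
    intro j hj i hi heq
    rcases Nat.lt_succ_iff_lt_or_eq.1 hj with h' | rfl
    exacts [ih h.2 j h' i hi heq, h.1 (heq ▸ mem_valueList hi)]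

theorem rotGraph_adj_rot_iterate (c k : ℕ) (i j : Fin 10) :
    (rotGraph c).Adj (rot^[k] i) (rot^[k] j) ↔ (rotGraph c).Adj i j := by
  rw [← rotIso_pow_apply c, ← rotIso_pow_apply c]
  exact (rotIso c ^ k).map_adj_iff

theorem rot_iterate_four (i : Fin 10) : rot^[4] i = i := by revert i; decide

/-- The automorphisms of the graphs are the powers of the rotation. -/
theorem exists_iso_eq_rot_iterate {c : ℕ} (hc : c ∈ params) (φ : rotGraph c ≃g rotGraph c) :
    ∃ k < 4, ∀ i, φ i = rot^[k] i := by
  obtain ⟨k, hk, h⟩ := exists_rot_search (forallExtensions_aut c hc) φ fun k j hj i hij => by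
    simp only [autCond, Bool.and_eq_true, bne_iff_ne, beq_iff_eq]
    have hne : searchVertex i ≠ searchVertex j := by
      revert j i; decide +kernel
    refine ⟨fun h => hne ?_, ?_⟩
    · rw [← rotIso_pow_apply c, ← rotIso_pow_apply c] at h
      exact φ.injective ((rotIso c ^ k).injective (Fin.ext h))
    · rw [← val_searchVertex i (by omega), ← val_searchVertex j hj, Bool.eq_iff_iff,
        ← rotGraph_adj_iff (params_lt hc), ← rotGraph_adj_iff (params_lt hc),
        rotGraph_adj_rot_iterate, φ.map_adj_iff]
  -- The values are listed from the last to the first, so the outcome of the search says that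
  -- `rot^[k] ∘ φ` is the identity.
  have hid : searchOrder.reverse = valueList (fun i => (searchVertex i : ℕ)) 10 := by
    decide +kernel
  rw [beq_iff_eq, hid] at h
  have hinv : ∀ i, rot^[k] (φ i) = i := fun i => by
    obtain ⟨j, hj, rfl⟩ := searchVertex_surjOn i
    exact Fin.ext (valueList_congr h j hj)
  have h' : ∀ i, φ i = rot^[4 - k] i := fun i => by
    rw [← rot_iterate_four (φ i), show 4 = (4 - k) + k by omega, Function.iterate_add_apply, hinv]
    congr 1
    omega
  rcases Nat.eq_zero_or_pos k with rfl | hk0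
  · exact ⟨0, by omega, fun i => (hinv i)⟩
  · exact ⟨4 - k, by omega, h'⟩

theorem isCore_rotGraph {c : ℕ} (hc : c ∈ [2, 6, 18, 22]) : (rotGraph c).IsCore := by
  have hc' : c < 32 := by revert c; decide
  intro f
  obtain ⟨k, -, h⟩ := exists_rot_search (forallExtensions_hom c hc) f fun k j hj i hij => by
    simp only [homCond, Bool.or_eq_true, Bool.not_eq_true', ← Bool.not_eq_true]
    rw [← val_searchVertex i (by omega), ← val_searchVertex j hj,
      ← rotGraph_adj_iff hc', ← rotGraph_adj_iff hc', rotGraph_adj_rot_iterate]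
    exact or_iff_not_imp_left.2 fun h => f.map_adj (not_not.1 h)
  refine Finite.injective_iff_bijective.1 fun v w hvw => ?_
  obtain ⟨i, hi, rfl⟩ := searchVertex_surjOn v
  obtain ⟨j, hj, rfl⟩ := searchVertex_surjOn w
  have := injOn_of_nodup_valueList (of_decide_eq_true h)
  rcases lt_trichotomy i j with hij | rfl | hij
  · exact absurd (by rw [hvw]) (this j hj i hij)
  · rfl
  · exact absurd (by rw [hvw]) (this i hi j hij)

/-! ### Invariants of the twelve graphs -/

/-- The pairs of edge number and minimum degree are all different, which makes the twelve graphs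
pairwise nonisomorphic. -/
theorem card_edgeFinset_rotGraph : ∀ x ∈ [(1, 20, 3), (2, 18, 3), (3, 22, 3), (6, 22, 4),
    (7, 26, 4), (11, 24, 4), (17, 21, 3), (18, 19, 3), (19, 23, 3), (22, 23, 4), (23, 27, 5),
    (27, 25, 4)], (rotGraph x.1).edgeFinset.card = x.2.1 ∧ (rotGraph x.1).minDegree = x.2.2 := by
  decide +kernel

theorem maxDegree_rotGraph : ∀ c ∈ params,
    4 ≤ (rotGraph c).maxDegree ∧ (rotGraph c).maxDegree ≤ 6 := by
  decide +kernel

/-- A vertex of a four-cycle has degree 3 plus its degree inside the cycle, and `8` and `9` have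
degree 4 or 5. All degrees are even only for K₄ and 2K₂ without the edge between `8` and `9`, which
is the parameter `11`. -/
theorem exists_odd_degree_rotGraph : ∀ c ∈ params, c ≠ 11 →
    ∃ v, ¬ Even ((rotGraph c).degree v) := by
  decide +kernel

/-- Whether the neighbours outside the set of vertices with the binary code `s` are at least `k`,
unless some vertex is neither in the set nor a neighbour. The list `N` holds the codes of the sets
of neighbours. -/
def boundaryCheck (k : ℕ) (N : List ℕ) (s : ℕ) : Bool :=
  (N.zipIdx.all fun v => s.testBit v.2 || (v.1 &&& s) != 0) ||
    k ≤ N.zipIdx.countP fun v => !s.testBit v.2 && (v.1 &&& s) != 0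

/-- The parameters of the graphs with their minimum degrees and the codes of the sets of
neighbours. -/
def neighborCodes : List (ℕ × ℕ × List ℕ) :=
   [(1, 3, [314, 613, 458, 661, 265, 515, 262, 524, 85, 170]),
    (2, 3, [308, 616, 449, 658, 265, 515, 262, 524, 85, 170]),
    (3, 3, [318, 621, 459, 663, 265, 515, 262, 524, 85, 170]),
    (6, 4, [308, 616, 449, 658, 425, 595, 422, 604, 85, 170]),
    (7, 4, [318, 621, 459, 663, 425, 595, 422, 604, 85, 170]),
    (11, 4, [318, 621, 459, 663, 329, 643, 278, 556, 85, 170]),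
    (17, 3, [314, 613, 458, 661, 265, 515, 262, 524, 597, 426]),
    (18, 3, [308, 616, 449, 658, 265, 515, 262, 524, 597, 426]),
    (19, 3, [318, 621, 459, 663, 265, 515, 262, 524, 597, 426]),
    (22, 4, [308, 616, 449, 658, 425, 595, 422, 604, 597, 426]),
    (23, 5, [318, 621, 459, 663, 425, 595, 422, 604, 597, 426]),
    (27, 4, [318, 621, 459, 663, 329, 643, 278, 556, 597, 426])]

theorem boundaryCheck_neighborCodes :
    ∀ x ∈ neighborCodes, ∀ s < 1024, s = 0 ∨ boundaryCheck x.2.1 x.2.2 s := by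
  decide +kernel

theorem neighborCodes_spec : ∀ x ∈ neighborCodes, x.2.2.length = 10 ∧ ∀ i j,
    (rotGraph x.1).Adj i j ↔ (x.2.2.getD i 0).testBit j := by
  decide +kernel

theorem triangle_rotGraph : ∀ c ∈ params, (rotGraph c).Adj 0 4 ∧ (rotGraph c).Adj 4 8 ∧
    (rotGraph c).Adj 0 8 := by
  decide +kernel

/-- All graphs contain the skeleton `rotGraph 0`, so one Hamiltonian cycle there serves for all. -/
theorem le_rotGraph : ∀ c ∈ params, ∀ i j, (rotGraph 0).Adj i j → (rotGraph c).Adj i j := by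
  decide +kernel

/-- Any nonempty set of vertices has at least `k` neighbours outside itself, unless some vertex is
neither in the set nor a neighbour. -/
def HasVertexBoundary {V : Type*} (G : SimpleGraph V) (k : ℕ) : Prop :=
  ∀ S : Set V, S.Nonempty → (∃ v ∉ S, ∀ w ∈ S, ¬ G.Adj w v) →
    k ≤ {v | v ∉ S ∧ ∃ w ∈ S, G.Adj w v}.ncard

theorem hasVertexBoundary_rotGraph {x : ℕ × ℕ × List ℕ} (hx : x ∈ neighborCodes) :
    (rotGraph x.1).HasVertexBoundary x.2.1 := by
  classical
  intro S hS ⟨u, huS, hu⟩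
  obtain ⟨hlen, hN⟩ := neighborCodes_spec x hx
  set s : ℕ := Nat.ofBits fun i : Fin 10 => decide (i ∈ S) with hs
  have hsb : ∀ i : Fin 10, s.testBit i = decide (i ∈ S) := fun i => by
    rw [hs, Nat.testBit_ofBits_lt _ _ i.2]
  have hs10 : s < 2 ^ 10 := Nat.ofBits_lt_two_pow _
  have hnbr : ∀ v : Fin 10, ((x.2.2.getD v 0 &&& s) != 0) = true ↔ ∃ w ∈ S, (rotGraph x.1).Adj w v := by
    intro v
    rw [bne_iff_ne]
    constructor
    · intro h
      obtain ⟨i, hi⟩ := Nat.exists_testBit_of_ne_zero h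
      rw [Nat.testBit_and, Bool.and_eq_true] at hi
      have hi10 : i < 10 := by
        by_contra hge
        rw [Nat.testBit_lt_two_pow (hs10.trans_le (Nat.pow_le_pow_right (by norm_num)
          (not_lt.1 hge)))] at hi
        exact Bool.noConfusion hi.2
      refine ⟨⟨i, hi10⟩, ?_, ?_⟩
      · have := hsb ⟨i, hi10⟩
        rw [hi.2] at this
        simpa using this.symm
      · exact ((hN v ⟨i, hi10⟩).2 hi.1).symm
    · rintro ⟨w, hw, hwv⟩ h0
      have := congrArg (fun n => n.testBit (w : ℕ)) h0
      simp only [Nat.testBit_and, (hN v w).1 hwv.symm, hsb, hw, decide_true, Bool.and_true,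
        Nat.zero_testBit] at this
      exact Bool.noConfusion this
  have hzip : x.2.2.zipIdx = (List.finRange 10).map fun v : Fin 10 => (x.2.2.getD v 0, (v : ℕ)) := by
    refine List.ext_getElem (by simp [hlen]) fun i h1 h2 => ?_
    have : i < x.2.2.length := by simpa using h1
    simp [this]
  rcases boundaryCheck_neighborCodes x hx s hs10 with h0 | h
  · obtain ⟨v, hv⟩ := hS
    have := hsb v
    simp [h0, hv] at this
  · rw [boundaryCheck, hzip, Bool.or_eq_true, List.all_eq_true, decide_eq_true_eq] at h
    rcases h with h | h
    · have := h _ (List.mem_map_of_mem (List.mem_finRange u))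
      rw [Bool.or_eq_true, hsb, hnbr u] at this
      rcases this with h | ⟨w, hw, hwu⟩
      exacts [absurd (of_decide_eq_true h) huS, absurd hwu (hu w hw)]
    · refine h.trans (le_of_eq ?_)
      rw [Set.ncard_eq_toFinset_card', List.countP_map, List.countP_eq_length_filter]
      have : {v | v ∉ S ∧ ∃ w ∈ S, (rotGraph x.1).Adj w v}.toFinset =
          Finset.univ.filter fun v : Fin 10 =>
            (!s.testBit v && (x.2.2.getD v 0 &&& s) != 0) = true := by
        ext v
        simp only [Set.mem_toFinset, Set.mem_ofPred_eq, Finset.mem_filter, Finset.mem_univ, true_and,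
          Bool.and_eq_true, hnbr, hsb]
        simp
      rw [this]
      simp only [Finset.card, Finset.filter, Fin.univ_def, Multiset.filter_coe, Multiset.coe_card]
      congr 2
      ext v
      simp [bne, beq_eq_decide]

/-- The cycle `0 5 9 1 6 2 7 3 4 8`. -/
theorem isHamiltonian_rotGraph_zero : (rotGraph 0).IsHamiltonian := by
  have h : ∀ i j : Fin 10, (i, j) ∈ [((0 : Fin 10), (5 : Fin 10)), (5, 9), (9, 1), (1, 6), (6, 2),
      (2, 7), (7, 3), (3, 4), (4, 8), (8, 0)] → (rotGraph 0).Adj i j := by decide +kernel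
  refine fun _ => ⟨0, .cons (h 0 5 (by decide)) (.cons (h 5 9 (by decide)) (.cons (h 9 1 (by decide))
    (.cons (h 1 6 (by decide)) (.cons (h 6 2 (by decide)) (.cons (h 2 7 (by decide))
    (.cons (h 7 3 (by decide)) (.cons (h 3 4 (by decide)) (.cons (h 4 8 (by decide))
    (.cons (h 8 0 (by decide)) .nil))))))))), ?_⟩
  rw [Walk.isHamiltonianCycle_iff_isCycle_and_support_count_tail_eq_one, Walk.isCycle_def,
    Walk.isTrail_def]
  refine ⟨⟨?_, by simp, ?_⟩, ?_⟩
  · simp only [Walk.edges_cons, Walk.edges_nil]; decide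
  · simp only [Walk.support_cons, Walk.support_nil]; decide
  · simp only [Walk.support_cons, Walk.support_nil]; decide

theorem isEulerian_rotGraph : (rotGraph 11).IsEulerianGraph := by
  let l : List (Fin 10) :=
    [0, 1, 2, 0, 3, 1, 5, 0, 4, 3, 2, 6, 1, 9, 3, 7, 5, 9, 7, 2, 8, 4, 6, 8, 0]
  have hl : l ≠ [] := by decide
  have hc : l.IsChain (rotGraph 11).Adj := by decide +kernel
  have he : ((Walk.ofSupport l hl hc).edges).Nodup ∧
      ∀ i j, (rotGraph 11).Adj i j → s(i, j) ∈ (Walk.ofSupport l hl hc).edges := by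
    rw [Walk.edges_eq_zipWith_support, Walk.support_ofSupport]
    decide +kernel
  exact ⟨0, Walk.ofSupport l hl hc, (Walk.isEulerian_iff _).2
    ⟨(Walk.isTrail_def _).2 he.1, Sym2.ind fun i j hij => he.2 i j hij⟩⟩

theorem isPlanar_rotGraph : (rotGraph 1).IsPlanar :=
  isPlanar_of_orientation (![(8, 9), (20, 0), (10, 3), (6, 4), (8, 6), (4, 20), (12, 3), (5, 2),
    (9, 5), (0, 0)] : Fin 10 → ℤ × ℤ) (by decide +kernel) (by decide +kernel) (by decide +kernel)

theorem not_isPlanar_rotGraph_two : ¬ (rotGraph 2).IsPlanar :=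
  not_isPlanar_of_subdivision ![0, 3, 6] ![1, 2, 4]
    ![![[5, 1], [2], [4]], ![[1], [7, 2], [4]], ![[1], [2], [8, 4]]]
    (by decide +kernel) (by decide +kernel) (by simp only [List.Disjoint]; decide +kernel)

theorem not_isPlanar_rotGraph_seventeen : ¬ (rotGraph 17).IsPlanar :=
  not_isPlanar_of_subdivision ![0, 2, 8] ![1, 3, 9]
    ![![[1], [3], [5, 9]], ![[1], [3], [7, 9]], ![[6, 1], [4, 3], [9]]]
    (by decide +kernel) (by decide +kernel) (by simp only [List.Disjoint]; decide +kernel)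

theorem isPlanar_rotGraph_iff {c : ℕ} (hc : c ∈ params) : (rotGraph c).IsPlanar ↔ c = 1 := by
  refine ⟨fun h => ?_, fun h => h ▸ isPlanar_rotGraph⟩
  have hle : ∀ c ∈ params, c ≠ 1 → (∀ i j, (rotGraph 2).Adj i j → (rotGraph c).Adj i j) ∨
      ∀ i j, (rotGraph 17).Adj i j → (rotGraph c).Adj i j := by decide +kernel
  by_contra hne
  rcases hle c hc hne with h' | h'
  · exact not_isPlanar_rotGraph_two (h.of_injective_hom ⟨id, h' _ _⟩ Function.injective_id)
  · exact not_isPlanar_rotGraph_seventeen (h.of_injective_hom ⟨id, h' _ _⟩ Function.injective_id)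

theorem isEulerianGraph_rotGraph_iff {c : ℕ} (hc : c ∈ params) :
    (rotGraph c).IsEulerianGraph ↔ c = 11 := by
  refine ⟨fun ⟨v, w, hw⟩ => ?_, fun h => h ▸ isEulerian_rotGraph⟩
  by_contra hne
  obtain ⟨u, hu⟩ := exists_odd_degree_rotGraph c hc hne
  exact hu (hw.even_degree_iff.2 fun h => absurd rfl h)

/-- The graphs with chromatic number three. -/
theorem exists_coloring_three : ∀ c ∈ [1, 17], ∃ f ∈ [(![0, 1, 0, 1, 2, 2, 2, 2, 1, 0] :
    Fin 10 → Fin 3)], ∀ i j, (rotGraph c).Adj i j → f i ≠ f j := by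
  decide +kernel

/-- Three explicit colourings suffice; taking them from a list keeps the check short. -/
theorem exists_coloring_four : ∀ c ∈ params, c ∉ [1, 17] → ∃ f ∈ [(![0, 0, 1, 1, 2, 1, 2, 0, 3, 2] :
    Fin 10 → Fin 4), ![0, 1, 2, 3, 1, 2, 0, 1, 3, 0], ![0, 1, 2, 3, 2, 3, 0, 1, 1, 0]],
    ∀ i j, (rotGraph c).Adj i j → f i ≠ f j := by
  decide +kernel

theorem complete_four_rotGraph : ∀ c ∈ params, c ∉ [1, 17] → c ∉ [2, 6, 18, 22] →
    ∀ i j : Fin 10, i < 4 → j < 4 → i ≠ j → (rotGraph c).Adj i j := by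
  decide +kernel

theorem exists_walk_three_rotGraph : ∀ c ∈ params, ∀ i j, i = j ∨ (rotGraph c).Adj i j ∨
    ∃ k, (rotGraph c).Adj i k ∧ (k = j ∨ (rotGraph c).Adj k j ∨
      ∃ l, (rotGraph c).Adj k l ∧ (rotGraph c).Adj l j) := by
  decide +kernel

theorem exists_not_adj_rotGraph : ∀ c ∈ params, ∀ i, ∃ j, i ≠ j ∧ ¬ (rotGraph c).Adj i j := by
  decide +kernel

theorem exists_center_rotGraph : ∀ c ∈ params, ∃ i, ∀ j, i = j ∨ (rotGraph c).Adj i j ∨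
    ∃ k, (rotGraph c).Adj i k ∧ (rotGraph c).Adj k j := by
  decide +kernel

/-! ### Connectivity from vertex boundaries -/

section connectivity

theorem HasVertexBoundary.of_iso {k : ℕ} (h : H.HasVertexBoundary k) (φ : G ≃g H) :
    G.HasVertexBoundary k := by
  rintro S hS ⟨v, hv, hv'⟩
  have := h (φ '' S) (hS.image _) ⟨φ v, by simpa using hv, by
    rintro _ ⟨w, hw, rfl⟩ h; exact hv' w hw (φ.map_adj_iff.1 h)⟩
  convert this using 1
  rw [← Set.ncard_image_of_injective _ φ.injective]
  congr 1
  ext w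
  obtain ⟨w, rfl⟩ := φ.surjective w
  rw [φ.injective.mem_set_image]
  refine and_congr (not_congr φ.injective.mem_set_image.symm) ⟨?_, ?_⟩
  · rintro ⟨a, ha, h⟩
    exact ⟨φ a, ⟨a, ha, rfl⟩, φ.map_adj_iff.2 h⟩
  · rintro ⟨_, ⟨a, ha, rfl⟩, h⟩
    exact ⟨a, ha, φ.map_adj_iff.1 h⟩

/-- If fewer than `k` removed vertices separate `u` from `v`, the boundary of the component of `u`
lies among the removed vertices, and `v` is neither in the component nor adjacent to it. -/
theorem HasVertexBoundary.isVertexConnected [Fintype V] {k : ℕ} (h : G.HasVertexBoundary k)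
    (hk : k < Fintype.card V) : G.IsVertexConnected k := by
  classical
  refine ⟨by simpa using hk, fun X hX => ?_⟩
  have hne : Nonempty {v | v ∉ X} := by
    obtain ⟨v, hv⟩ : ∃ v, v ∉ X := by
      by_contra! hall
      rw [Finset.eq_univ_iff_forall.2 hall, Finset.card_univ] at hX
      omega
    exact ⟨⟨v, hv⟩⟩
  refine ⟨fun u v => ?_⟩
  by_contra huv
  let S : Set V := {w | ∃ hw : w ∉ X, (G.induce {v | v ∉ X}).Reachable u ⟨w, hw⟩}
  have hstep : ∀ a ∈ S, ∀ b ∉ X, G.Adj a b → b ∈ S := by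
    rintro a ⟨ha, hua⟩ b hb hab
    exact ⟨hb, hua.trans (Adj.reachable (by simpa using hab))⟩
  have hcard := h S ⟨u, u.2, Reachable.refl _⟩ ⟨v, fun ⟨_, hv⟩ => huv hv, fun w hw hwv =>
    huv (hstep w hw v v.2 hwv).2⟩
  have hsub : {v | v ∉ S ∧ ∃ w ∈ S, G.Adj w v} ⊆ (X : Set V) := by
    rintro b ⟨hb, a, ha, hab⟩
    by_contra hbX
    exact hb (hstep a ha b hbX hab)
  have := Set.ncard_le_ncard hsub X.finite_toSet
  rw [Set.ncard_coe_finset] at this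
  omega

/-- Each boundary vertex is the only end outside `S` of an edge chosen for it, so the chosen edges
are different. -/
theorem ncard_boundary_le [Finite V] {S : Set V} {s : Set (Sym2 V)}
    (h : ∀ a ∈ S, ∀ b ∉ S, G.Adj a b → s(a, b) ∈ s) :
    {v | v ∉ S ∧ ∃ w ∈ S, G.Adj w v}.ncard ≤ s.ncard := by
  choose! f hf using fun v (hv : v ∈ {v | v ∉ S ∧ ∃ w ∈ S, G.Adj w v}) => hv.2
  refine Set.ncard_le_ncard_of_injOn (fun v => s(f v, v))
    (fun v hv => h _ (hf v hv).1 _ hv.1 (hf v hv).2) (fun v hv w hw hvw => ?_) (Set.toFinite _)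
  rcases Sym2.eq_iff.1 hvw with h' | h'
  · exact h'.2
  · exact absurd (h'.1 ▸ (hf v hv).1) hw.1

/-- Either side of a cut with fewer than `k` edges has fewer than `k` boundary vertices, so it must
be adjacent to everything outside. Then the other side is that boundary. Both sides are thus smaller
than `k`, against `2 * k ≤ |V|`. -/
theorem HasVertexBoundary.isEdgeConnected [Fintype V] {k : ℕ} (h : G.HasVertexBoundary k)
    (hk : 2 * k ≤ Fintype.card V) : G.IsEdgeConnected k := by
  classical
  intro u v s hs
  by_contra huv
  have hs' : s.ncard < k := by
    rwa [← (Set.toFinite s).cast_ncard_eq, Nat.cast_lt] at hs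
  let S : Set V := {w | (G.deleteEdges s).Reachable u w}
  have hS : ∀ a ∈ S, ∀ b ∉ S, G.Adj a b → s(a, b) ∈ s := by
    intro a ha b hb hab
    by_contra hn
    exact hb (Reachable.trans ha (Adj.reachable (deleteEdges_adj.2 ⟨hab, hn⟩)))
  have hS' : ∀ a ∈ Sᶜ, ∀ b ∉ Sᶜ, G.Adj a b → s(a, b) ∈ s := fun a ha b hb hab =>
    Sym2.eq_swap ▸ hS b (not_not.1 hb) a ha hab.symm
  have key : ∀ T : Set V, T.Nonempty → (∀ a ∈ T, ∀ b ∉ T, G.Adj a b → s(a, b) ∈ s) →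
      Tᶜ.ncard < k := by
    intro T hT hTs
    have h1 := ncard_boundary_le hTs
    by_cases hall : ∃ v ∉ T, ∀ w ∈ T, ¬ G.Adj w v
    · have := h T hT hall
      omega
    · push Not at hall
      have : {v | v ∉ T ∧ ∃ w ∈ T, G.Adj w v} = Tᶜ := by
        ext v
        exact ⟨fun h => h.1, fun hv => ⟨hv, hall v hv⟩⟩
      rw [this] at h1
      omega
  have h1 := key S ⟨u, Reachable.refl _⟩ hS
  have h2 := key Sᶜ ⟨v, huv⟩ hS'
  rw [compl_compl] at h2
  have h3 := Set.ncard_add_ncard_compl S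
  rw [Nat.card_eq_fintype_card] at h3
  omega

/-- Removing the neighbours of `v` isolates it from some remaining vertex. -/
theorem IsVertexConnected.le_degree [Fintype V] [DecidableRel G.Adj] {k : ℕ}
    (h : G.IsVertexConnected k) (v : V) : k ≤ G.degree v := by
  classical
  by_contra! hlt
  have hk : k < Fintype.card V := by simpa using h.1
  obtain ⟨w, hw⟩ : ∃ w, w ∉ insert v (G.neighborFinset v) := by
    by_contra! hall
    have := Finset.card_insert_le v (G.neighborFinset v)
    rw [Finset.eq_univ_iff_forall.2 hall, Finset.card_univ, card_neighborFinset_eq_degree] at this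
    omega
  rw [Finset.mem_insert, not_or] at hw
  have hc := h.2 (G.neighborFinset v) (by rwa [card_neighborFinset_eq_degree])
  obtain ⟨p⟩ := hc ⟨v, by simp⟩ ⟨w, hw.2⟩
  cases p with
  | nil => exact hw.1 rfl
  | @cons _ x _ h' _ => exact x.2 (by simpa using h')

theorem HasVertexBoundary.vertexConnectivity_eq [Fintype V] [DecidableRel G.Adj] [Nonempty V]
    (h : G.HasVertexBoundary G.minDegree) : G.vertexConnectivity = G.minDegree := by
  refine IsGreatest.csSup_eq ⟨h.isVertexConnected G.minDegree_lt_card, fun k hk => ?_⟩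
  obtain ⟨v, hv⟩ := G.exists_minimal_degree_vertex
  exact hv ▸ hk.le_degree v

theorem HasVertexBoundary.edgeConnectivity_eq [Fintype V] [DecidableRel G.Adj] [Nontrivial V]
    (h : G.HasVertexBoundary G.minDegree) (hk : 2 * G.minDegree ≤ Fintype.card V) :
    G.edgeConnectivity = G.minDegree := by
  refine IsGreatest.csSup_eq ⟨h.isEdgeConnected hk, fun k hk => ?_⟩
  obtain ⟨v, hv⟩ := G.exists_minimal_degree_vertex
  exact hv ▸ IsEdgeConnected.le_degree hk

end connectivity

/-! ### Cores -/

section core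

theorem isCore_top {n : ℕ} : (⊤ : SimpleGraph (Fin n)).IsCore := fun f =>
  Finite.injective_iff_bijective.1 f.injective_of_top_hom

/-- A bijective endomorphism of a finite graph reflects adjacency. -/
theorem adj_of_bijective_endomorphism [Finite V] (f : G →g G) (hf : Function.Bijective f) {u v : V}
    (h : G.Adj (f u) (f v)) : G.Adj u v := by
  let σ : Equiv.Perm V := Equiv.ofBijective f hf
  obtain ⟨n, hn, hσ⟩ := (isOfFinOrder_of_finite σ).exists_pow_eq_one
  obtain ⟨m, rfl⟩ : ∃ m, n = m + 1 := ⟨n - 1, by omega⟩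
  have hpow : ∀ k x y, G.Adj x y → G.Adj ((σ ^ k) x) ((σ ^ k) y) := by
    intro k
    induction k with
    | zero => exact fun x y h => h
    | succ k ih => exact fun x y h => ih _ _ (f.map_adj h)
  have := hpow m _ _ h
  have e : ∀ x, (σ ^ m) (f x) = x := fun x => by
    change (σ ^ (m + 1)) x = x
    rw [hσ]; rfl
  rwa [e, e] at this

/-- Both composites of the homomorphisms between `C` and `H` are bijective endomorphisms, so each
homomorphism is bijective, and adjacency is reflected through the composite. -/
theorem IsCoreOf.nonempty_iso [Finite V] {C : G.Subgraph} (hC : G.IsCoreOf C) (hH : H.IsCore)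
    (f : G →g H) (g : H →g G) : Nonempty (C.coe ≃g H) := by
  obtain ⟨hC, ⟨r⟩⟩ := hC
  let a : C.coe →g H := f.comp C.hom
  let b : H →g C.coe := r.comp g
  have hba : Function.Bijective (b ∘ a) := hC (b.comp a)
  have hab : Function.Bijective (a ∘ b) := hH (a.comp b)
  refine ⟨⟨Equiv.ofBijective a ⟨hba.1.of_comp, hab.2.of_comp⟩, fun {u v} => ?_⟩⟩
  exact ⟨fun h => adj_of_bijective_endomorphism (b.comp a) hba (b.map_adj h), fun h => a.map_adj h⟩

theorem exists_isCoreOf [Finite V] (hH : H.IsCore) (f : G →g H) (g : H →g G) :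
    ∃ C : G.Subgraph, G.IsCoreOf C := by
  -- The image of `H` under `g` is a core: an endomorphism of it, placed between `g'` and `f`,
  -- becomes an endomorphism of `H` and hence injective, while `g'` is surjective.
  let C : G.Subgraph := (⊤ : H.Subgraph).map g
  let g' : H →g C.coe := ⟨fun v => ⟨g v, v, trivial, rfl⟩, fun {u v} h => ⟨u, v, h, rfl, rfl⟩⟩
  have hg' : Function.Surjective g' := by
    rintro ⟨_, v, -, rfl⟩
    exact ⟨v, rfl⟩
  refine ⟨C, fun h => Finite.injective_iff_bijective.1 fun x y hxy => ?_, ⟨g'.comp f⟩⟩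
  have hb := hH (((f.comp C.hom).comp h).comp g')
  obtain ⟨u, rfl⟩ := hg' x
  obtain ⟨v, rfl⟩ := hg' y
  rw [hb.1 (congrArg (fun z => f (C.hom z)) hxy)]

theorem IsCore.core_iso [Finite V] (hH : H.IsCore) (f : G →g H) (g : H →g G) :
    (∃ C : G.Subgraph, G.IsCoreOf C) ∧
      ∀ C : G.Subgraph, G.IsCoreOf C → Nonempty (C.coe ≃g H) :=
  ⟨exists_isCoreOf hH f g, fun _ hC => hC.nonempty_iso hH f g⟩

end core

/-! ### Diameter and radius -/

section distance

theorem Hom.edist_le (f : G →g H) (u v : V) : H.edist (f u) (f v) ≤ G.edist u v :=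
  le_iInf fun p => (Walk.edist_le (p.map f)).trans (by simp)

theorem Iso.eccent_eq (φ : G ≃g H) (u : V) : H.eccent (φ u) = G.eccent u := by
  rw [eccent_def, eccent_def]
  refine (φ.surjective.iSup_congr φ fun v => le_antisymm (Hom.edist_le φ.toHom u v) ?_).symm
  simpa using Hom.edist_le φ.symm.toHom (φ u) (φ v)

theorem Iso.ediam_eq (φ : G ≃g H) : H.ediam = G.ediam :=
  (φ.surjective.iSup_congr φ fun v => φ.eccent_eq v).symm

theorem Iso.diam_eq (φ : G ≃g H) : H.diam = G.diam := congrArg ENat.toNat φ.ediam_eq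

theorem Iso.radius_eq (φ : G ≃g H) : H.radius = G.radius :=
  (φ.surjective.iInf_congr φ fun v => φ.eccent_eq v).symm

theorem radius_rotGraph {c : ℕ} (hc : c ∈ params) : (rotGraph c).radius = 2 := by
  refine le_antisymm ?_ (le_iInf fun i => ?_)
  · obtain ⟨i, hi⟩ := exists_center_rotGraph c hc
    refine radius_le_eccent.trans ((eccent_le_iff i 2).2 fun j => ?_)
    rcases hi j with rfl | h | ⟨k, h, h'⟩
    · simp
    · exact (Walk.edist_le (.cons h .nil)).trans (by norm_num)
    · exact (Walk.edist_le (.cons h (.cons h' .nil))).trans (by norm_num)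
  · by_contra! hlt
    obtain ⟨j, hj, hij⟩ := exists_not_adj_rotGraph c hc i
    exact hij ((eccent_le_one_iff i).1 (Order.le_of_lt_add_one (by simpa [one_add_one_eq_two] using hlt)) j hj)

theorem ediam_rotGraph_le {c : ℕ} (hc : c ∈ params) : (rotGraph c).ediam ≤ 3 := by
  refine ediam_le_of_edist_le fun i j => ?_
  rcases exists_walk_three_rotGraph c hc i j with rfl | h | ⟨k, h, rfl | h' | ⟨l, h', h''⟩⟩
  · simp
  · exact (Walk.edist_le (.cons h .nil)).trans (by norm_num)
  · exact (Walk.edist_le (.cons h .nil)).trans (by norm_num)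
  · exact (Walk.edist_le (.cons h (.cons h' .nil))).trans (by norm_num)
  · exact (Walk.edist_le (.cons h (.cons h' (.cons h'' .nil)))).trans (by norm_num)

theorem diam_rotGraph {c : ℕ} (hc : c ∈ params) :
    2 ≤ (rotGraph c).diam ∧ (rotGraph c).diam ≤ 3 := by
  have h3 := ediam_rotGraph_le hc
  have h2 : 2 ≤ (rotGraph c).ediam := radius_rotGraph hc ▸ radius_le_ediam
  lift (rotGraph c).ediam to ℕ using (ne_top_of_le_ne_top (by simp) h3) with d hd
  rw [diam, ← hd]
  exact ⟨by exact_mod_cast h2, by exact_mod_cast h3⟩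

end distance

/-! ### Transport along isomorphisms, and the automorphism groups of the twelve graphs -/

section transport

theorem IsHamiltonian.of_iso [Fintype V] [Fintype W] [DecidableEq V] [DecidableEq W]
    (h : G.IsHamiltonian) (φ : G ≃g H) : H.IsHamiltonian := fun hW => by
  obtain ⟨a, p, hp⟩ := h (by rwa [Fintype.card_congr φ.toEquiv])
  exact ⟨φ a, p.map φ.toHom, hp.map φ.bijective⟩

theorem IsEulerianGraph.of_iso [DecidableEq V] [DecidableEq W] (h : G.IsEulerianGraph)
    (φ : G ≃g H) : H.IsEulerianGraph := by
  obtain ⟨v, c, hc⟩ := h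
  obtain ⟨ht, hm⟩ := (Walk.isEulerian_iff _).1 hc
  refine ⟨φ v, c.map φ.toHom, (Walk.isEulerian_iff _).2
    ⟨(Walk.isTrail_map_iff_of_injective φ.injective).2 ht, fun e he => ?_⟩⟩
  rw [Walk.edges_map]
  refine List.mem_map.2 ⟨e.map φ.symm, hm _ (φ.symm.map_mem_edgeSet_iff.2 he), ?_⟩
  rw [Sym2.map_map]
  exact (Sym2.map_congr fun x _ => φ.apply_symm_apply x).trans (congrFun Sym2.map_id' e)

theorem Iso.isPlanar_iff (φ : G ≃g H) : G.IsPlanar ↔ H.IsPlanar :=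
  ⟨fun h => h.of_injective_hom φ.symm.toHom φ.symm.injective,
    fun h => h.of_injective_hom φ.toHom φ.injective⟩

theorem Iso.isEulerianGraph_iff [DecidableEq V] [DecidableEq W] (φ : G ≃g H) :
    G.IsEulerianGraph ↔ H.IsEulerianGraph :=
  ⟨fun h => h.of_iso φ, fun h => h.of_iso φ.symm⟩

/-- The automorphism groups of isomorphic graphs are isomorphic. -/
def autCongr (φ : G ≃g H) : (G ≃g G) ≃* (H ≃g H) where
  toFun ψ := (φ.symm.trans ψ).trans φ
  invFun ψ := (φ.trans ψ).trans φ.symm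
  left_inv ψ := by ext v; simp
  right_inv ψ := by ext v; simp
  map_mul' ψ χ := by
    ext v
    change φ (ψ (χ (φ.symm v))) = φ (ψ (φ.symm (φ (χ (φ.symm v)))))
    rw [φ.symm_apply_apply]

theorem Iso.hasAutZ4_iff (φ : G ≃g H) : G.HasAutZ4 ↔ H.HasAutZ4 :=
  ⟨fun ⟨e⟩ => ⟨(autCongr φ).symm.trans e⟩, fun ⟨e⟩ => ⟨(autCongr φ).trans e⟩⟩

theorem hasAutZ4_rotGraph {c : ℕ} (hc : c ∈ params) : (rotGraph c).HasAutZ4 := by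
  have hpow : (rotIso c) ^ 4 = 1 := by
    ext i; rw [rotIso_pow_apply, rot_iterate_four]; rfl
  have hord : orderOf (rotIso c) = 4 := by
    refine orderOf_eq_prime_pow (p := 2) (n := 1) (fun h => ?_) hpow
    have : rot^[2 ^ 1] 0 = 0 := by rw [← rotIso_pow_apply c, h]; rfl
    exact absurd this (by decide)
  have hgen : ∀ ψ, ψ ∈ Subgroup.zpowers (rotIso c) := fun ψ => by
    obtain ⟨k, -, hk⟩ := exists_iso_eq_rot_iterate hc ψ
    refine ⟨k, ?_⟩
    ext i
    simp only [zpow_natCast, rotIso_pow_apply, hk]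
  have hcyc : IsCyclic (rotGraph c ≃g rotGraph c) := ⟨rotIso c, hgen⟩
  have hcard : Nat.card (rotGraph c ≃g rotGraph c) = 4 :=
    (orderOf_eq_card_of_forall_mem_zpowers hgen).symm.trans hord
  exact ⟨(hcard ▸ zmodCyclicMulEquiv hcyc).symm⟩

end transport

/-! ### Classification -/

/-- The rotation `(0 1 2 3)(4 5 6 7)`. -/
def rotFix : Fin 10 → Fin 10 := ![1, 2, 3, 0, 5, 6, 7, 4, 8, 9]

/-- A decimal digit of `n`. -/
def digit (n i : ℕ) : ℕ := n / 10 ^ i % 10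

/-- The map whose values at `9, …, 0` are the decimal digits of `n`. -/
def digitMap (n : ℕ) (i : Fin 10) : Fin 10 := ⟨digit n i, Nat.mod_lt _ (by norm_num)⟩

/-- Some maps that reverse the cycles of the rotations. -/
def reflections : List ℕ :=
  [9856741230, 9867451230, 9874561230, 9845671230, 8967451230, 8945671230]

/-- Some maps that permute the orbits of the rotation. -/
def relabelings : List ℕ :=
  [9876543210, 8976543210, 9847653210, 8947653210, 9854763210, 8954763210,
    9865473210, 8965473210, 9856741230, 8956741230, 9867451230, 8967451230,
    9874561230, 8974561230, 9845671230, 8945671230]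

/-- A map that interchanges the cycles of length four of the rotation. -/
def interchange : Fin 10 → Fin 10 := ![4, 7, 6, 5, 0, 3, 2, 1, 8, 9]

/-- The diagonal is excluded because its single digit covers several orbits. -/
theorem entry_orbitTable_spec : ∀ i j i' j' : Fin 10, i ≠ j →
    entry orbitTable i j = entry orbitTable i' j' →
      ∃ k < 4, (rot^[k] i = i' ∧ rot^[k] j = j') ∨ (rot^[k] i = j' ∧ rot^[k] j = i') := by
  decide +kernel

theorem entry_orbitTableFix_spec : ∀ i j i' j' : Fin 10, i ≠ j →
    entry orbitTableFix i j = entry orbitTableFix i' j' →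
      ∃ k < 4, (rotFix^[k] i = i' ∧ rotFix^[k] j = j') ∨
        (rotFix^[k] i = j' ∧ rotFix^[k] j = i') := by
  decide +kernel

/-- The map with the digits `n` takes each orbit in the table `T` to itself or permutes the first
eight orbits in a way that takes the digits of `s` to those of `t`. -/
def permutesOrbits (T s t n : ℕ) : Bool :=
  (List.range 10).all fun i => (List.range 10).all fun j =>
    bif (entry T i j).blt 8 then
      (entry T (digit n i) (digit n j)).blt 8 &&
        s.testBit (entry T (digit n i) (digit n j)) == t.testBit (entry T i j)
    else entry T (digit n i) (digit n j) == entry T i j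

theorem permutesOrbits_spec {T s t n : ℕ} (h : permutesOrbits T s t n) (i j : Fin 10) :
    (entry T (digitMap n i) (digitMap n j) = entry T i j ∧ 8 ≤ entry T i j) ∨
    (entry T i j < 8 ∧ entry T (digitMap n i) (digitMap n j) < 8 ∧
      s.testBit (entry T (digitMap n i) (digitMap n j)) = t.testBit (entry T i j)) := by
  simp only [permutesOrbits, List.all_eq_true, List.mem_range] at h
  have := h i i.2 j j.2
  simp only [digitMap]
  by_cases h8 : entry T i j < 8
  · have hb : (entry T i j).blt 8 = true := by simpa [Nat.blt_eq] using h8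
    rw [hb, cond_true, Bool.and_eq_true, Nat.blt_eq, beq_iff_eq] at this
    exact Or.inr ⟨h8, this⟩
  · have hb : (entry T i j).blt 8 = false := by simpa [← Bool.not_eq_true, Nat.blt_eq] using h8
    rw [hb, cond_false, beq_iff_eq] at this
    exact Or.inl ⟨this, not_lt.1 h8⟩

theorem reflections_spec : ∀ n ∈ reflections, Function.Injective (digitMap n) ∧
    (∃ i, digitMap n (rot i) ≠ rot (digitMap n i)) ∧
    ∃ i, digitMap n (rotFix i) ≠ rotFix (digitMap n i) := by
  decide +kernel

theorem relabelings_spec : ∀ n ∈ relabelings, Function.Injective (digitMap n) := by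
  decide +kernel

/-- Every subset of ℤ/4 is invariant under some `d ↦ k - d`, and the fixed vertices `8` and `9` are
each joined to all or none of a four-cycle. -/
theorem exists_reflection_orbitTableFix : ((List.range 256).all fun s =>
    reflections.any fun n => permutesOrbits orbitTableFix s s n) = true := by
  decide +kernel

/-- No reflection exists only for two consecutive differences between the four-cycles and exactly
one orbit of edges from each four-cycle to `8`, `9`. These 4 · 2 · 2 codes are all carried to 83,
that is, to the orbits 0, 1, 4, 6. -/
theorem exists_reflection_or_relabeling_orbitTable : ((List.range 256).all fun s =>
    (reflections.any fun n => permutesOrbits orbitTable s s n) ||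
      relabelings.any fun n => permutesOrbits orbitTable s 83 n) = true := by
  decide +kernel

/-- The map preserves the skeleton and exchanges the circulants on the two four-cycles. It is an
automorphism if these agree; otherwise one of their two orders is listed in `params`. -/
theorem interchange_spec : ∀ c < 32, c ∈ params ∨
    (∃ d ∈ params, ∀ i j, (rotGraph d).Adj (interchange i) (interchange j) ↔
      (rotGraph c).Adj i j) ∨
    ∀ i j, (rotGraph c).Adj (interchange i) (interchange j) ↔ (rotGraph c).Adj i j := by
  decide +kernel

/-- Adjacency in a graph with a given automorphism depends on the orbits of pairs only. -/
theorem exists_orbit_predicate {H : SimpleGraph (Fin 10)} {r : Fin 10 → Fin 10} {T : ℕ}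
    (hT : ∀ i j i' j' : Fin 10, i ≠ j → entry T i j = entry T i' j' →
      ∃ k < 4, (r^[k] i = i' ∧ r^[k] j = j') ∨ (r^[k] i = j' ∧ r^[k] j = i'))
    (hH : ∀ i j, H.Adj i j → H.Adj (r i) (r j)) :
    ∃ p : ℕ → Prop, ∀ i j : Fin 10, H.Adj i j ↔ p (entry T i j) := by
  have hk : ∀ k i j, H.Adj i j → H.Adj (r^[k] i) (r^[k] j) := by
    intro k
    induction k with
    | zero => exact fun i j h => h
    | succ k ih => exact fun i j h => ih _ _ (hH _ _ h)
  refine ⟨fun t => ∃ i j : Fin 10, entry T i j = t ∧ H.Adj i j,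
    fun i j => ⟨fun h => ⟨i, j, rfl, h⟩, ?_⟩⟩
  rintro ⟨i', j', he, h⟩
  obtain ⟨k, -, ⟨rfl, rfl⟩ | ⟨rfl, rfl⟩⟩ := hT _ _ _ _ h.ne he
  exacts [hk k _ _ h, (hk k _ _ h).symm]

theorem exists_code (p : ℕ → Prop) (n : ℕ) : ∃ s < 2 ^ n, ∀ t < n, s.testBit t = true ↔ p t := by
  classical
  exact ⟨Nat.ofBits fun t : Fin n => decide (p t), Nat.ofBits_lt_two_pow _, fun t ht => by
    rw [Nat.testBit_ofBits_lt _ _ ht, decide_eq_true_eq]⟩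

theorem adj_digitMap_iff {H : SimpleGraph (Fin 10)} {T s : ℕ} {p : ℕ → Prop}
    (hp : ∀ i j : Fin 10, H.Adj i j ↔ p (entry T i j)) (hs : ∀ t < 8, s.testBit t = true ↔ p t)
    {n : ℕ} (hn : permutesOrbits T s s n) (i j : Fin 10) :
    H.Adj (digitMap n i) (digitMap n j) ↔ H.Adj i j := by
  rw [hp, hp]
  rcases permutesOrbits_spec hn i j with h | ⟨h, h', h''⟩
  · rw [h.1]
  · rw [← hs _ h, ← hs _ h', h'']

/-- An isomorphism from a bijection of vertices. -/
noncomputable def isoOfInjective {G : SimpleGraph (Fin 10)} {H : SimpleGraph (Fin 10)}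
    (f : Fin 10 → Fin 10) (hf : Function.Injective f)
    (h : ∀ i j, H.Adj (f i) (f j) ↔ G.Adj i j) : G ≃g H where
  toEquiv := Equiv.ofBijective f (Finite.injective_iff_bijective.1 hf)
  map_rel_iff' := h _ _

theorem HasAutZ4.comm (h : G.HasAutZ4) (φ ψ : G ≃g G) (v : V) : φ (ψ v) = ψ (φ v) := by
  obtain ⟨e⟩ := h
  have : φ * ψ = ψ * φ := e.injective (by rw [map_mul, map_mul, mul_comm])
  exact congrArg (fun χ : G ≃g G => χ v) this

theorem HasAutZ4.exists_iso (h : G.HasAutZ4) :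
    ∃ σ : G ≃g G, (∀ v, σ (σ (σ (σ v))) = v) ∧ ∃ v, σ (σ v) ≠ v := by
  obtain ⟨e⟩ := h
  let σ := e.symm (Multiplicative.ofAdd 1)
  refine ⟨σ, fun v => ?_, ?_⟩
  · have : σ * (σ * (σ * σ)) = 1 := by
      simp only [σ, ← map_mul]
      rw [← map_one e.symm]
      exact congrArg e.symm (by decide)
    exact congrArg (fun χ : G ≃g G => χ v) this
  · by_contra! hall
    have h1 : σ * σ = 1 := by ext v; exact hall v
    simp only [σ, ← map_mul] at h1
    rw [← map_one e.symm] at h1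
    exact absurd (e.symm.injective h1) (by decide)

/-- Exchanging two vertices with the same neighbours is an automorphism. -/
def swapIso [DecidableEq V] (x y : V) (h : ∀ w, w ≠ x → w ≠ y → (G.Adj x w ↔ G.Adj y w)) :
    G ≃g G where
  toEquiv := Equiv.swap x y
  map_rel_iff' := by
    intro u v
    simp only [Equiv.swap_apply_def]
    have h' : ∀ w, w ≠ x → w ≠ y → (G.Adj w x ↔ G.Adj w y) := fun w hx hy => by
      rw [G.adj_comm, h w hx hy, G.adj_comm]
    split_ifs <;> grind [G.adj_comm, G.irrefl]

/-- An automorphism of order four of a graph with automorphism group `ℤ/4ℤ` moves at least two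
cycles of length four. -/
theorem HasAutZ4.exists_second_cycle (h : G.HasAutZ4) (σ : G ≃g G)
    (hσ : ∀ v, σ (σ (σ (σ v))) = v) (a : V) (ha : σ (σ a) ≠ a) :
    ∃ b, σ (σ b) ≠ b ∧ b ≠ a ∧ b ≠ σ a ∧ b ≠ σ (σ a) ∧ b ≠ σ (σ (σ a)) := by
  classical
  by_contra! hall
  -- All vertices off the cycle of `a` are fixed by σ², which exchanges `σ a` and `σ³ a`; these two
  -- are therefore twins.
  have key : ∀ w, w ≠ σ a → w ≠ σ (σ (σ a)) → (G.Adj (σ a) w ↔ G.Adj (σ (σ (σ a))) w) := by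
    intro w h1 h3
    by_cases h0 : w = a
    · subst h0
      rw [G.adj_comm, ← σ.map_adj_iff, ← σ.map_adj_iff, ← σ.map_adj_iff, hσ]
    by_cases h2 : w = σ (σ a)
    · subst h2
      rw [σ.map_adj_iff, G.adj_comm, σ.map_adj_iff, σ.map_adj_iff, G.adj_comm]
    have hw : σ (σ w) = w := by
      by_contra hw
      exact h3 (hall w hw h0 h1 h2)
    rw [← σ.map_adj_iff, ← σ.map_adj_iff, hw]
  have hne : σ a ≠ a := fun h => ha (by rw [h, h])
  have hne3 : σ (σ (σ a)) ≠ a := fun h => hne (by conv_lhs => rw [← h, hσ])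
  have := h.comm σ (swapIso _ _ key) a
  change σ (Equiv.swap _ _ a) = Equiv.swap _ _ (σ a) at this
  rw [Equiv.swap_apply_of_ne_of_ne hne.symm hne3.symm, Equiv.swap_apply_left] at this
  exact ha (σ.injective this.symm)

theorem exists_notMem_of_card_lt [Fintype V] [DecidableEq V] (l : List V)
    (h : l.length < Fintype.card V) : ∃ x, x ∉ l := by
  by_contra! hall
  have : l.toFinset = Finset.univ := Finset.eq_univ_iff_forall.2 fun x => by simpa using hall x
  have := List.toFinset_card_le l
  simp_all
  omega

/-- The structure of a permutation of ten points with two cycles of length four. -/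
theorem exists_equiv_of_two_cycles [Fintype V] [DecidableEq V] (hV : Fintype.card V = 10)
    (s : V → V) (hs : ∀ v, s (s (s (s v))) = v) {a b : V} (ha : s (s a) ≠ a) (hb : s (s b) ≠ b)
    (h0 : b ≠ a) (h1 : b ≠ s a) (h2 : b ≠ s (s a)) (h3 : b ≠ s (s (s a))) :
    ∃ e : Fin 10 ≃ V, (∀ i, s (e i) = e (rot i)) ∨ ∀ i, s (e i) = e (rotFix i) := by
  have mk : ∀ x y, x ∉ [a, s a, s (s a), s (s (s a)), b, s b, s (s b), s (s (s b))] →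
      y ∉ [a, s a, s (s a), s (s (s a)), b, s b, s (s b), s (s (s b)), x] →
      ∃ e : Fin 10 ≃ V, ⇑e = ![a, s a, s (s a), s (s (s a)), b, s b, s (s b), s (s (s b)), x, y] := by
    intro x y hx hy
    have hinj : Function.Injective
        ![a, s a, s (s a), s (s (s a)), b, s b, s (s b), s (s (s b)), x, y] := by
      rw [← List.nodup_ofFn]
      simp only [List.mem_cons, List.not_mem_nil, not_or, or_false] at hx hy
      have hsa := hs a
      have hsb := hs b
      simp only [List.ofFn_succ, List.nodup_cons, List.mem_cons, not_or]
      and_intros <;> simp <;> grind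
    exact ⟨Equiv.ofBijective _ ((Fintype.bijective_iff_injective_and_card _).2
      ⟨hinj, by simp [hV]⟩), rfl⟩
  obtain ⟨x, hx⟩ := exists_notMem_of_card_lt
    [a, s a, s (s a), s (s (s a)), b, s b, s (s b), s (s (s b))] (by simp [hV])
  by_cases hsx : s x = x
  · obtain ⟨y, hy⟩ := exists_notMem_of_card_lt
      [a, s a, s (s a), s (s (s a)), b, s b, s (s b), s (s (s b)), x] (by simp [hV])
    obtain ⟨e, he⟩ := mk x y hx hy
    -- The other nine points are permuted among themselves by `s`, so `y` has no other image left.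
    have hsy : s y = y := by
      obtain ⟨i, hi⟩ := e.surjective (s y)
      simp only [List.mem_cons, List.not_mem_nil, not_or, or_false] at hx hy
      rw [he] at hi
      fin_cases i <;> simp at hi <;> grind
    refine ⟨e, Or.inr fun i => ?_⟩
    rw [he]
    fin_cases i <;> simp [rotFix, hs, hsx, hsy]
  · have hy : s x ∉ [a, s a, s (s a), s (s (s a)), b, s b, s (s b), s (s (s b)), x] := by
      simp only [List.mem_cons, List.not_mem_nil, not_or, or_false] at hx ⊢
      grind
    obtain ⟨e, he⟩ := mk x (s x) hx hy
    have hsy : s (s x) = x := by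
      obtain ⟨i, hi⟩ := e.surjective (s (s x))
      simp only [List.mem_cons, List.not_mem_nil, not_or, or_false] at hx hy
      rw [he] at hi
      fin_cases i <;> simp at hi <;> grind
    refine ⟨e, Or.inl fun i => ?_⟩
    rw [he]
    fin_cases i <;> simp [rot, hs, hsy]

theorem HasAutZ4.exists_iso_rotGraph_of_rot {H : SimpleGraph (Fin 10)} (h : H.HasAutZ4)
    (φ : H ≃g H) (hφ : ∀ i, φ i = rot i) : ∃ c < 32, Nonempty (rotGraph c ≃g H) := by
  obtain ⟨p, hp⟩ := exists_orbit_predicate entry_orbitTable_spec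
    fun i j hij => hφ i ▸ hφ j ▸ φ.map_adj_iff.2 hij
  obtain ⟨s, hs, hsp⟩ := exists_code p 8
  have hall := List.all_eq_true.1 exists_reflection_or_relabeling_orbitTable s (List.mem_range.2 hs)
  rw [Bool.or_eq_true, List.any_eq_true, List.any_eq_true] at hall
  rcases hall with ⟨f, hf, hfs⟩ | ⟨f, hf, hfs⟩
  · obtain ⟨hinj, ⟨i, hi⟩, -⟩ := reflections_spec f hf
    have := h.comm (isoOfInjective (digitMap f) hinj (adj_digitMap_iff hp hsp hfs)) φ i
    rw [hφ, hφ] at this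
    exact absurd this hi
  · obtain ⟨c, hc, hcp⟩ := exists_code (fun t => p (t + 8)) 5
    refine ⟨c, hc, ⟨isoOfInjective (digitMap f) (relabelings_spec f hf) fun i j => ?_⟩⟩
    -- Because `83 < 2 ^ 8`, the low eight bits encode the skeleton and the bits of `c` encode the
    -- orbits 8 to 12.
    have hbit : ∀ t, (83 + 256 * c).testBit t =
        if t < 8 then (83).testBit t else c.testBit (t - 8) := fun t => by
      rw [add_comm]
      exact Nat.testBit_two_pow_mul_add c (by norm_num : 83 < 2 ^ 8) t
    have hd : ∀ i j : Fin 10, i ≠ j → entry orbitTable i j < 13 := by decide +kernel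
    rw [rotGraph_adj_iff hc, adjb, hbit]
    rcases permutesOrbits_spec hfs i j with ⟨h1, h2⟩ | ⟨h1, h2, h3⟩
    · rw [if_neg (not_lt.2 h2)]
      by_cases hij : i = j
      · subst hij
        have hd' : ∀ i : Fin 10, entry orbitTable i i = 13 := by decide +kernel
        rw [hd' i, Nat.testBit_lt_two_pow (hc : c < 2 ^ (13 - 8))]
        simp
      · have := hd i j hij
        rw [hp, h1, hcp _ (by omega), Nat.sub_add_cancel h2]
    · rw [if_pos h1, hp, ← hsp _ h2, h3]

theorem HasAutZ4.exists_iso_params {c : ℕ} (hc : c < 32) (h : (rotGraph c).HasAutZ4) :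
    ∃ d ∈ params, Nonempty (rotGraph c ≃g rotGraph d) := by
  have hinj : Function.Injective interchange := by decide +kernel
  rcases interchange_spec c hc with h' | ⟨d, hd, h'⟩ | h'
  · exact ⟨c, h', ⟨Iso.refl⟩⟩
  · exact ⟨d, hd, ⟨isoOfInjective interchange hinj h'⟩⟩
  · have := h.comm (isoOfInjective interchange hinj h') (rotIso c) 0
    exact absurd this (by change ¬ interchange (rot 0) = rot (interchange 0); decide)

/-- The classification of the graphs on ten vertices with automorphism group `ℤ/4ℤ`. -/
theorem HasAutZ4.exists_iso_rotGraph [Fintype V] [DecidableEq V] (hV : Fintype.card V = 10)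
    (h : G.HasAutZ4) : ∃ c ∈ params, Nonempty (G ≃g rotGraph c) := by
  obtain ⟨σ, hσ, a, ha⟩ := h.exists_iso
  obtain ⟨b, hb, h0, h1, h2, h3⟩ := h.exists_second_cycle σ hσ a ha
  obtain ⟨e, he⟩ := exists_equiv_of_two_cycles hV σ hσ ha hb h0 h1 h2 h3
  let ε : G.comap e ≃g G := Iso.comap e G
  have hH : (G.comap e).HasAutZ4 := (Iso.hasAutZ4_iff ε).2 h
  let φ : G.comap e ≃g G.comap e := (autCongr ε).symm σ
  have hφ : ∀ i, φ i = e.symm (σ (e i)) := fun i => rfl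
  rcases he with he | he
  · obtain ⟨c, hc, ⟨ψ⟩⟩ := hH.exists_iso_rotGraph_of_rot φ fun i => by
      rw [hφ, he, e.symm_apply_apply]
    obtain ⟨d, hd, ⟨χ⟩⟩ := HasAutZ4.exists_iso_params hc ((Iso.hasAutZ4_iff ψ).2 hH)
    exact ⟨d, hd, ⟨(ε.symm.trans ψ.symm).trans χ⟩⟩
  · have hφ' : ∀ i, φ i = rotFix i := fun i => by rw [hφ, he, e.symm_apply_apply]
    obtain ⟨p, hp⟩ := exists_orbit_predicate entry_orbitTableFix_spec
      fun i j hij => hφ' i ▸ hφ' j ▸ φ.map_adj_iff.2 hij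
    obtain ⟨s, hs, hsp⟩ := exists_code p 8
    obtain ⟨f, hf, hfs⟩ := List.any_eq_true.1
      (List.all_eq_true.1 exists_reflection_orbitTableFix s (List.mem_range.2 hs))
    obtain ⟨hinj, -, i, hi⟩ := reflections_spec f hf
    have := hH.comm (isoOfInjective (digitMap f) hinj (adj_digitMap_iff hp hsp hfs)) φ i
    rw [hφ', hφ'] at this
    exact absurd this hi

/-! ### Counting classes -/

/-- The six representatives have at most 22 of the 45 possible edges, so none is isomorphic to the
complement of any of them. -/
theorem card_edgeFinset_compl_rotGraph : ∀ c ∈ [1, 2, 3, 6, 17, 18],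
    (rotGraph c).edgeFinset.card ≤ 22 ∧ 23 ≤ (rotGraph c)ᶜ.edgeFinset.card := by
  decide +kernel

theorem bounds_rotGraph : ∀ c ∈ params,
    (18 ≤ (rotGraph c).edgeFinset.card ∧ (rotGraph c).edgeFinset.card ≤ 27) ∧
    (3 ≤ (rotGraph c).minDegree ∧ (rotGraph c).minDegree ≤ 5) := by
  decide +kernel

theorem eq_of_iso_rotGraph {c d : ℕ} (hc : c ∈ params) (hd : d ∈ params)
    (φ : rotGraph c ≃g rotGraph d) : c = d := by
  have key : ∀ x ∈ params, ∃ e k, (x, e, k) ∈ [(1, 20, 3), (2, 18, 3), (3, 22, 3), (6, 22, 4),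
    (7, 26, 4), (11, 24, 4), (17, 21, 3), (18, 19, 3), (19, 23, 3), (22, 23, 4), (23, 27, 5),
    (27, 25, 4)] := by simp [params]
  obtain ⟨e, k, h⟩ := key c hc
  obtain ⟨e', k', h'⟩ := key d hd
  obtain ⟨h1, h2⟩ := card_edgeFinset_rotGraph _ h
  obtain ⟨h1', h2'⟩ := card_edgeFinset_rotGraph _ h'
  rw [φ.card_edgeFinset_eq] at h1
  rw [φ.minDegree_eq] at h2
  obtain rfl : e = e' := h1.symm.trans h1'
  obtain rfl : k = k' := h2.symm.trans h2'
  simp only [List.mem_cons, Prod.mk.injEq, List.not_mem_nil, or_false] at h h'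
  omega

theorem hasVertexBoundary_minDegree_rotGraph {c : ℕ} (hc : c ∈ params) :
    (rotGraph c).HasVertexBoundary (rotGraph c).minDegree := by
  have : ∀ c ∈ params, ∃ x ∈ neighborCodes, x.1 = c ∧ x.2.1 = (rotGraph c).minDegree := by
    decide +kernel
  obtain ⟨x, hx, rfl, h⟩ := this c hc
  exact h ▸ hasVertexBoundary_rotGraph hx

/-- The classes of the graphs that satisfy `P`, if these are the graphs isomorphic to the graphs
with parameters in `L`. -/
theorem ncard_isoClasses {P : SimpleGraph V → Prop} (e : V ≃ Fin 10) (L : Finset ℕ)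
    (hL : ∀ c ∈ L, c ∈ params) (h1 : ∀ G, P G → ∃ c ∈ L, Nonempty (G ≃g rotGraph c))
    (h2 : ∀ c ∈ L, ∀ G : SimpleGraph V, (G ≃g rotGraph c) → P G) :
    (isoClasses P).ncard = L.card := by
  have : isoClasses P =
      (fun c => Quotient.mk (isoSetoid V) ((rotGraph c).comap e)) '' (L : Set ℕ) := by
    ext q
    constructor
    · rintro ⟨G, hG, rfl⟩
      obtain ⟨c, hc, ⟨φ⟩⟩ := h1 G hG
      exact ⟨c, hc, Quotient.sound ⟨(Iso.comap e _).trans φ.symm⟩⟩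
    · rintro ⟨c, hc, rfl⟩
      exact ⟨_, h2 c hc _ (Iso.comap e _), rfl⟩
  rw [this, Set.InjOn.ncard_image, Set.ncard_coe_finset]
  intro c hc d hd hcd
  obtain ⟨φ⟩ := Quotient.exact hcd
  exact eq_of_iso_rotGraph (hL c hc) (hL d hd) (((Iso.comap e _).symm.trans φ).trans (Iso.comap e _))

theorem exists_compl_iso_rotGraph {c : ℕ} (hc : c ∈ params) : ∃ d ∈ [1, 2, 3, 6, 17, 18],
    Nonempty (rotGraph c ≃g rotGraph d) ∨ Nonempty (rotGraph c ≃g (rotGraph d)ᶜ) := by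
  -- The map exchanges the two four-cycles and takes the skeleton to its complement within the
  -- orbits 0 to 7.
  have h : ∀ c ∈ params, c ∈ [1, 2, 3, 6, 17, 18] ∨ ∃ d ∈ [1, 2, 3, 6, 17, 18], ∀ i j,
      (rotGraph d)ᶜ.Adj (digitMap 8930125674 i) (digitMap 8930125674 j) ↔
        (rotGraph c).Adj i j := by
    decide +kernel
  rcases h c hc with h | ⟨d, hd, h⟩
  · exact ⟨c, h, Or.inl ⟨Iso.refl⟩⟩
  · exact ⟨d, hd, Or.inr ⟨isoOfInjective _ (by decide +kernel) h⟩⟩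

theorem ncard_isoOrComplClasses [Fintype V] [DecidableEq V] (hV : Fintype.card V = 10) :
    (isoOrComplClasses (V := V) fun G => G.HasAutZ4).ncard = 6 := by
  let e : V ≃ Fin 10 := Fintype.equivFinOfCardEq hV
  have hp : ∀ c ∈ [1, 2, 3, 6, 17, 18], c ∈ params := by decide
  have : isoOrComplClasses (V := V) (fun G => G.HasAutZ4) =
      (fun c => Quotient.mk (isoOrComplSetoid V) ((rotGraph c).comap e)) ''
        (([1, 2, 3, 6, 17, 18] : List ℕ).toFinset : Set ℕ) := by
    ext q
    constructor
    · rintro ⟨G, hG, rfl⟩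
      obtain ⟨c, hc, ⟨φ⟩⟩ := HasAutZ4.exists_iso_rotGraph hV hG
      obtain ⟨d, hd, h⟩ := exists_compl_iso_rotGraph hc
      refine ⟨d, by simpa using hd, Quotient.sound ((isoOrComplSetoid V).symm ?_)⟩
      rcases h with ⟨⟨ψ⟩⟩ | ⟨⟨ψ⟩⟩
      · exact Or.inl ⟨(φ.trans ψ).trans (Iso.comap e _).symm⟩
      · exact Or.inr ⟨(φ.trans ψ).trans (isoCompl (Iso.comap e _)).symm⟩
    · rintro ⟨c, hc, rfl⟩
      exact ⟨_, (Iso.hasAutZ4_iff (Iso.comap e _)).2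
        (hasAutZ4_rotGraph (hp c (by simpa using hc))), rfl⟩
  rw [this, Set.InjOn.ncard_image, Set.ncard_coe_finset]
  · decide
  intro c hc d hd hcd
  have hc : c ∈ [1, 2, 3, 6, 17, 18] := by simpa using hc
  have hd : d ∈ [1, 2, 3, 6, 17, 18] := by simpa using hd
  rcases Quotient.exact hcd with ⟨⟨φ⟩⟩ | ⟨⟨φ⟩⟩
  · exact eq_of_iso_rotGraph (hp c hc) (hp d hd)
      (((Iso.comap e _).symm.trans φ).trans (Iso.comap e _))
  · have h1 := (card_edgeFinset_compl_rotGraph c hc).1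
    have h2 := (card_edgeFinset_compl_rotGraph d hd).2
    rw [Iso.card_edgeFinset_eq
      (((Iso.comap e _).symm.trans φ).trans (isoCompl (Iso.comap e _)))] at h1
    omega

/-! ### Orbits and transitivity -/

/-- Division by 4 numbers the cycles `0…3`, `4…7` and `8, 9` of the rotation as 0, 1, 2. -/
theorem rot_iterate_div : ∀ k < 4, ∀ i : Fin 10, (rot^[k] i : ℕ) / 4 = i / 4 := by decide +kernel

/-- An automorphism keeps the cycles of the rotation. -/
theorem Iso.div_apply {c : ℕ} (hc : c ∈ params) (φ : G ≃g rotGraph c) (ψ : G ≃g G) (v : V) :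
    (φ (ψ v) : ℕ) / 4 = φ v / 4 := by
  obtain ⟨k, hk, h⟩ := exists_iso_eq_rot_iterate hc (autCongr φ ψ)
  have := h (φ v)
  change φ (ψ (φ.symm (φ v))) = _ at this
  rw [φ.symm_apply_apply] at this
  rw [this, rot_iterate_div k hk]

theorem Iso.orbit_eq {c : ℕ} (hc : c ∈ params) (φ : G ≃g rotGraph c) (v : V) :
    MulAction.orbit (G ≃g G) v = {w | (φ w : ℕ) / 4 = φ v / 4} := by
  ext w
  constructor
  · rintro ⟨ψ, rfl⟩
    exact φ.div_apply hc ψ v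
  · intro hw
    have h : ∀ i j : Fin 10, (i : ℕ) / 4 = j / 4 → ∃ k < 4, rot^[k] j = i := by decide +kernel
    obtain ⟨k, -, hk⟩ := h _ _ hw
    refine ⟨(autCongr φ).symm (rotIso c ^ k), ?_⟩
    change φ.symm ((rotIso c ^ k) (φ v)) = w
    rw [rotIso_pow_apply, hk, φ.symm_apply_apply]

theorem ncard_cycle (φ : V ≃ Fin 10) (n : ℕ) :
    {w | (φ w : ℕ) / 4 = n}.ncard = (Finset.univ.filter fun i : Fin 10 => (i : ℕ) / 4 = n).card := by
  rw [← Set.ncard_coe_finset, ← Set.ncard_image_of_injective _ φ.injective]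
  congr 1
  ext i
  obtain ⟨v, rfl⟩ := φ.surjective i
  simp

theorem exists_orbits {c : ℕ} (hc : c ∈ params) (φ : G ≃g rotGraph c) :
    ∃ A B C : Set V, A ≠ B ∧ A.ncard = 4 ∧ B.ncard = 4 ∧ C.ncard = 2 ∧
      Set.range (fun v : V => MulAction.orbit (G ≃g G) v) = {A, B, C} := by
  refine ⟨{w | (φ w : ℕ) / 4 = 0}, {w | (φ w : ℕ) / 4 = 1}, {w | (φ w : ℕ) / 4 = 2}, ?_,
    (ncard_cycle φ.toEquiv 0).trans (by decide), (ncard_cycle φ.toEquiv 1).trans (by decide),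
    (ncard_cycle φ.toEquiv 2).trans (by decide), ?_⟩
  · intro h
    have : φ.symm 0 ∈ {w | (φ w : ℕ) / 4 = 1} := h ▸ by simp
    simp at this
  · ext S
    simp only [Set.mem_range, Set.mem_insert_iff, Set.mem_singleton_iff, φ.orbit_eq hc]
    constructor
    · rintro ⟨v, rfl⟩
      have : (φ v : ℕ) / 4 = 0 ∨ (φ v : ℕ) / 4 = 1 ∨ (φ v : ℕ) / 4 = 2 := by omega
      rcases this with h | h | h <;> simp [h]
    · rintro (rfl | rfl | rfl)
      exacts [⟨φ.symm 0, by simp⟩, ⟨φ.symm 4, by simp⟩, ⟨φ.symm 8, by simp⟩]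

theorem not_isVertexTransitive {c : ℕ} (hc : c ∈ params) (φ : G ≃g rotGraph c) :
    ¬ G.IsVertexTransitive := fun h => by
  obtain ⟨ψ, hψ⟩ := h (φ.symm 0) (φ.symm 4)
  have := φ.div_apply hc ψ (φ.symm 0)
  simp [hψ] at this

theorem not_isDistanceTransitive {c : ℕ} (hc : c ∈ params) (φ : G ≃g rotGraph c) :
    ¬ G.IsDistanceTransitive := fun h =>
  not_isVertexTransitive hc φ fun u v => (h u u v v (by simp)).imp fun _ h => h.1

/-- The edge `04` has an end in the first orbit and the edge `48` has none. -/
theorem not_isEdgeTransitive {c : ℕ} (hc : c ∈ params) (φ : G ≃g rotGraph c) :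
    ¬ G.IsEdgeTransitive := fun h => by
  obtain ⟨h04, h48, -⟩ := triangle_rotGraph c hc
  obtain ⟨ψ, hψ⟩ := h s(φ.symm 0, φ.symm 4) (φ.symm.map_adj_iff.2 h04)
    s(φ.symm 4, φ.symm 8) (φ.symm.map_adj_iff.2 h48)
  have h0 := φ.div_apply hc ψ (φ.symm 0)
  rcases Sym2.eq_iff.1 hψ with ⟨h1, -⟩ | ⟨h1, -⟩ <;> simp [h1] at h0

/-! ### Girth, cores, colourings and the counts of planar and Eulerian graphs -/

theorem girth_rotGraph {c : ℕ} (hc : c ∈ params) : (rotGraph c).girth = 3 := by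
  obtain ⟨h04, h48, h08⟩ := triangle_rotGraph c hc
  have hcyc : (Walk.cons h04 (.cons h48 (.cons h08.symm .nil))).IsCycle := by
    rw [Walk.isCycle_def, Walk.isTrail_def]
    refine ⟨?_, by simp, ?_⟩
    · simp only [Walk.edges_cons, Walk.edges_nil]; decide
    · simp only [Walk.support_cons, Walk.support_nil]; decide
  exact le_antisymm (girth_le_length hcyc) (three_le_girth fun h => h _ hcyc)

theorem nonempty_hom_top_three {c : ℕ} (hc : c ∈ params) :
    Nonempty ((⊤ : SimpleGraph (Fin 3)) →g rotGraph c) := by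
  obtain ⟨h04, h48, h08⟩ := triangle_rotGraph c hc
  refine ⟨⟨![0, 4, 8], fun {i j} hij => ?_⟩⟩
  fin_cases i <;> fin_cases j <;> first | exact absurd rfl hij | simpa [adj_comm]

theorem colorable_four_rotGraph {c : ℕ} (hc : c ∈ params) : (rotGraph c).Colorable 4 := by
  by_cases h : c ∈ [1, 17]
  · obtain ⟨f, -, hf⟩ := exists_coloring_three c h
    exact Colorable.mono (by norm_num) ⟨Coloring.mk f fun {i j} hij => hf i j hij⟩
  · obtain ⟨f, -, hf⟩ := exists_coloring_four c hc h
    exact ⟨Coloring.mk f fun {i j} hij => hf i j hij⟩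

/-- For `1` and `17` a triangle and a 3-colouring give K₃. For `2`, `6`, `18`, `22` the graph is
itself a core. In the other cases the first four-cycle induces K₄, which a 4-colouring makes the
core. -/
theorem core_iso_of_iso {c : ℕ} [Finite V] (hc : c ∈ params) (φ : G ≃g rotGraph c) :
    (∃ C : G.Subgraph, G.IsCoreOf C) ∧ ∀ C : G.Subgraph, G.IsCoreOf C →
      Nonempty (C.coe ≃g (⊤ : SimpleGraph (Fin 3))) ∨
      Nonempty (C.coe ≃g (⊤ : SimpleGraph (Fin 4))) ∨ Nonempty (C.coe ≃g G) := by
  by_cases h : c ∈ [1, 17]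
  · obtain ⟨f, -, hf⟩ := exists_coloring_three c h
    obtain ⟨g⟩ := nonempty_hom_top_three hc
    have := isCore_top.core_iso ((⟨f, fun {i j} hij => hf i j hij⟩ : rotGraph c →g ⊤).comp φ.toHom)
      (φ.symm.toHom.comp g)
    exact ⟨this.1, fun C hC => Or.inl (this.2 C hC)⟩
  by_cases h' : c ∈ [2, 6, 18, 22]
  · have := (isCore_rotGraph h').core_iso φ.toHom φ.symm.toHom
    exact ⟨this.1, fun C hC => Or.inr (Or.inr ((this.2 C hC).map fun ψ => ψ.trans φ.symm))⟩
  · obtain ⟨f, -, hf⟩ := exists_coloring_four c hc h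
    let g : (⊤ : SimpleGraph (Fin 4)) →g rotGraph c :=
      ⟨Fin.castLE (by norm_num), fun {i j} hij => complete_four_rotGraph c hc h h' _ _
        (by exact i.2) (by exact j.2) ((Fin.castLE_injective _).ne hij)⟩
    have := isCore_top.core_iso ((⟨f, fun {i j} hij => hf i j hij⟩ : rotGraph c →g ⊤).comp φ.toHom)
      (φ.symm.toHom.comp g)
    exact ⟨this.1, fun C hC => Or.inr (Or.inl (this.2 C hC))⟩

theorem ncard_isoClasses_hasAutZ4 [Fintype V] [DecidableEq V] (hV : Fintype.card V = 10) :
    (isoClasses (V := V) fun G => G.HasAutZ4).ncard = 12 :=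
  ncard_isoClasses (Fintype.equivFinOfCardEq hV) params.toFinset
    (fun _ hc => List.mem_toFinset.1 hc)
    (fun G hG => by
      obtain ⟨c, hc, h⟩ := HasAutZ4.exists_iso_rotGraph hV hG
      exact ⟨c, List.mem_toFinset.2 hc, h⟩)
    (fun _ hc _ φ => (Iso.hasAutZ4_iff φ).2 (hasAutZ4_rotGraph (List.mem_toFinset.1 hc)))

theorem ncard_isoClasses_isPlanar [Fintype V] [DecidableEq V] (hV : Fintype.card V = 10) :
    (isoClasses (V := V) fun G => G.HasAutZ4 ∧ G.IsPlanar).ncard = 1 :=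
  ncard_isoClasses (Fintype.equivFinOfCardEq hV) {1} (by decide)
    (fun G ⟨hG, hP⟩ => by
      obtain ⟨c, hc, ⟨φ⟩⟩ := HasAutZ4.exists_iso_rotGraph hV hG
      exact ⟨c, Finset.mem_singleton.2
        ((isPlanar_rotGraph_iff hc).1 ((Iso.isPlanar_iff φ).1 hP)), ⟨φ⟩⟩)
    (fun c hc G φ => by
      obtain rfl := Finset.mem_singleton.1 hc
      exact ⟨(Iso.hasAutZ4_iff φ).2 (hasAutZ4_rotGraph (by decide)),
        (Iso.isPlanar_iff φ).2 isPlanar_rotGraph⟩)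

theorem ncard_isoClasses_isEulerianGraph [Fintype V] [DecidableEq V]
    (hV : Fintype.card V = 10) :
    (isoClasses (V := V) fun G => G.HasAutZ4 ∧ G.IsEulerianGraph).ncard = 1 :=
  ncard_isoClasses (Fintype.equivFinOfCardEq hV) {11} (by decide)
    (fun G ⟨hG, hE⟩ => by
      obtain ⟨c, hc, ⟨φ⟩⟩ := HasAutZ4.exists_iso_rotGraph hV hG
      exact ⟨c, Finset.mem_singleton.2
        ((isEulerianGraph_rotGraph_iff hc).1 ((Iso.isEulerianGraph_iff φ).1 hE)), ⟨φ⟩⟩)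
    (fun c hc G φ => by
      obtain rfl := Finset.mem_singleton.1 hc
      exact ⟨(Iso.hasAutZ4_iff φ).2 (hasAutZ4_rotGraph (by decide)),
        (Iso.isEulerianGraph_iff φ).2 isEulerian_rotGraph⟩)

theorem cliqueNum_bounds {c : ℕ} [Finite V] (hc : c ∈ params) (φ : G ≃g rotGraph c) :
    3 ≤ G.cliqueNum ∧ (G.cliqueNum : ℕ∞) ≤ G.chromaticNumber ∧ G.chromaticNumber ≤ 4 := by
  classical
  obtain ⟨h04, h48, h08⟩ := triangle_rotGraph c hc
  have h : G.IsNClique 3 {φ.symm 0, φ.symm 4, φ.symm 8} :=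
    is3Clique_triple_iff.2 ⟨φ.symm.map_adj_iff.2 h04, φ.symm.map_adj_iff.2 h08,
      φ.symm.map_adj_iff.2 h48⟩
  refine ⟨?_, cliqueNum_le_chromaticNumber, ?_⟩
  · rw [← h.card_eq]
    exact IsClique.card_le_cliqueNum (tc := h.isClique)
  · exact ((colorable_four_rotGraph hc).of_hom φ.toHom).chromaticNumber_le

theorem connectivity_eq {c : ℕ} [Fintype V] [DecidableRel G.Adj] (hc : c ∈ params)
    (φ : G ≃g rotGraph c) :
    G.vertexConnectivity = G.minDegree ∧ G.edgeConnectivity = G.minDegree := by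
  have hV : Fintype.card V = 10 := (Fintype.card_congr φ.toEquiv).trans (Fintype.card_fin 10)
  have : Nontrivial V := Fintype.one_lt_card_iff_nontrivial.1 (by omega)
  have hB := (hasVertexBoundary_minDegree_rotGraph hc).of_iso φ
  have hδ := (bounds_rotGraph c hc).2.2
  rw [← Iso.minDegree_eq φ] at hB hδ
  exact ⟨hB.vertexConnectivity_eq, hB.edgeConnectivity_eq (by omega)⟩

end SimpleGraph

theorem mainTheorem1 {V : Type*} [Fintype V] [DecidableEq V] (hV : Fintype.card V = 10) :
    -- the number of isomorphism classes, and their number up to complementation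
    (SimpleGraph.isoClasses (V := V) fun Γ => Γ.HasAutZ4).ncard = 12 ∧
    (SimpleGraph.isoOrComplClasses (V := V) fun Γ => Γ.HasAutZ4).ncard = 6 ∧
    -- the properties of each of the graphs
    (∀ (Γ : SimpleGraph V) [DecidableRel Γ.Adj], Γ.HasAutZ4 →
      (18 ≤ Γ.edgeFinset.card ∧ Γ.edgeFinset.card ≤ 27) ∧
      (3 ≤ Γ.minDegree ∧ Γ.minDegree ≤ 5) ∧
      (4 ≤ Γ.maxDegree ∧ Γ.maxDegree ≤ 6) ∧
      (∃ A B C : Set V, A ≠ B ∧ A.ncard = 4 ∧ B.ncard = 4 ∧ C.ncard = 2 ∧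
        Set.range (fun v : V => MulAction.orbit (Γ ≃g Γ) v) = {A, B, C}) ∧
      Γ.girth = 3 ∧
      (3 ≤ Γ.cliqueNum ∧ Γ.cliqueNum ≤ 4) ∧
      ((∃ C : Γ.Subgraph, Γ.IsCoreOf C) ∧
        ∀ C : Γ.Subgraph, Γ.IsCoreOf C →
          Nonempty (C.coe ≃g (⊤ : SimpleGraph (Fin 3))) ∨
          Nonempty (C.coe ≃g (⊤ : SimpleGraph (Fin 4))) ∨
          Nonempty (C.coe ≃g Γ)) ∧
      (3 ≤ Γ.vertexConnectivity ∧ Γ.vertexConnectivity ≤ 5 ∧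
        Γ.vertexConnectivity = Γ.edgeConnectivity) ∧
      (2 ≤ Γ.diam ∧ Γ.diam ≤ 3) ∧
      Γ.radius = 2 ∧
      (3 ≤ Γ.chromaticNumber ∧ Γ.chromaticNumber ≤ 4) ∧
      Γ.IsHamiltonian ∧
      ¬ Γ.IsVertexTransitive ∧ ¬ Γ.IsEdgeTransitive ∧ ¬ Γ.IsDistanceTransitive) ∧
    -- exactly one class of planar graphs, and exactly one class of Eulerian graphs
    (SimpleGraph.isoClasses (V := V) fun Γ => Γ.HasAutZ4 ∧ Γ.IsPlanar).ncard = 1 ∧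
    (SimpleGraph.isoClasses (V := V) fun Γ => Γ.HasAutZ4 ∧ Γ.IsEulerianGraph).ncard = 1 := by
  refine ⟨SimpleGraph.ncard_isoClasses_hasAutZ4 hV, SimpleGraph.ncard_isoOrComplClasses hV,
    fun Γ _ hΓ => ?_, SimpleGraph.ncard_isoClasses_isPlanar hV,
    SimpleGraph.ncard_isoClasses_isEulerianGraph hV⟩
  obtain ⟨c, hc, ⟨φ⟩⟩ := hΓ.exists_iso_rotGraph hV
  obtain ⟨hE, hδ⟩ := SimpleGraph.bounds_rotGraph c hc
  have hΔ := SimpleGraph.maxDegree_rotGraph c hc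
  rw [← SimpleGraph.Iso.card_edgeFinset_eq φ] at hE
  rw [← SimpleGraph.Iso.minDegree_eq φ] at hδ
  rw [← SimpleGraph.Iso.maxDegree_eq φ] at hΔ
  obtain ⟨hκ, hl⟩ := SimpleGraph.connectivity_eq hc φ
  obtain ⟨hω, hωχ, hχ⟩ := SimpleGraph.cliqueNum_bounds hc φ
  refine ⟨hE, hδ, hΔ, SimpleGraph.exists_orbits hc φ,
    (SimpleGraph.Iso.girth_eq φ).trans (SimpleGraph.girth_rotGraph hc),
    ⟨hω, by exact_mod_cast hωχ.trans hχ⟩, SimpleGraph.core_iso_of_iso hc φ,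
    ⟨hκ ▸ hδ.1, hκ ▸ hδ.2, hκ.trans hl.symm⟩, ?_, ?_,
    ⟨le_trans (by exact_mod_cast hω) hωχ, hχ⟩,
    (SimpleGraph.isHamiltonian_rotGraph_zero.mono
      fun i j h => SimpleGraph.le_rotGraph c hc i j h).of_iso φ.symm,
    SimpleGraph.not_isVertexTransitive hc φ, SimpleGraph.not_isEdgeTransitive hc φ,
    SimpleGraph.not_isDistanceTransitive hc φ⟩
  · rw [← SimpleGraph.Iso.diam_eq φ]
    exact SimpleGraph.diam_rotGraph hc
  · rw [← SimpleGraph.Iso.radius_eq φ]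
    exact SimpleGraph.radius_rotGraph hc
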